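/- **Theorem (Local Linear Convergence of OGDA).** *Setting.* A finite two-player zero-sum discounted Markov game has state space $\mathcal S=[S]$, action sets $\mathcal A=[A]$ (min-player) and $\mathcal B=[B]$ (max-player), $S,A,B\ge 1$, transition kernel $\mathbb P(\cdot\mid s,a,b)\in\Delta_{\mathcal S}$, rewards $R_s(a,b)\in[0,1]$ and discount factor $\gamma\in[0,1)$. A policy pair is $z=(x,y)$ with $z_s=(x_s,y_s)\in\Delta_{\mathcal A}\times\Delta_{\mathcal B}$ for every $s$; $\mathcal Z$ is the set of policy pairs, with the Euclidean norm of $\mathbb R^{(A+B)S}$. Let $V^{x,y}(s)=\mathbb E_{x,y}\big[\sum_{t\ge 0}\gamma^t R_{s^t}(a^t,b^t)\mid s^0=s\big]$, where $a^t\sim x_{s^t}$, $b^t\sim y_{s^t}$, $s^{t+1}\sim\mathbb P(\cdot\mid s^t,a^t,b^t)$; for $v\in\mathbb R^S$ let $Q_s[v](a,b)=R_s(a,b)+\gamma\sum_{s'}\mathbb P(s'\mid s,a,b)v(s')$; let $Q^{x,y}_s=Q_s[V^{x,y}]$, $v^*(s)=\min_x\max_y V^{x,y}(s)$ and $Q^*_s=Q_s[v^*]$.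 Put $$\mathcal X^*_s=\operatorname*{argmin}_{x'\in\Delta_{\mathcal A}}\max_{y'\in\Delta_{\mathcal B}}x'^\top Q^*_sy',\qquad \mathcal Y^*_s=\operatorname*{argmax}_{y'\in\Delta_{\mathcal B}}\min_{x'\in\Delta_{\mathcal A}}x'^\top Q^*_sy',\qquad \mathcal Z^*_s=\mathcal X^*_s\times\mathcal Y^*_s,\qquad \mathcal Z^*=\prod_s\mathcal Z^*_s$$ ($\mathcal Z^*$ is the set of Nash equilibria), and let $\mathrm{dist}$ be Euclidean distance. *Condition constant.* An *error-bound constant* of the game is a number $c_+>0$ such that, for all $z=(x,y)\in\mathcal Z$ and $s\in\mathcal S$, $$\max_{y'\in\Delta_{\mathcal B}}x_s^\top Q^*_sy'-\min_{x'\in\Delta_{\mathcal A}}x'^\top Q^*_sy_s\ \ge\ c_+\,\mathrm{dist}(z_s,\mathcal Z^*_s).$$ *Algorithm.* OGDA on the time interval $[T_1:T_2]$ with initial pair $\hat z\in\mathcal Z$ and stepsize $\eta>0$ sets $\tilde z^{T_1}=z^{T_1}=\hat z$ and, for $t\in[T_1+1:T_2]$ and every $s$, with $Q^t_s=Q^{x^t,y^t}_s$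 and $\mathcal P$ the Euclidean projection, $$x^t_s=\mathcal P_{\Delta_{\mathcal A}}(\tilde x^{t-1}_s-\eta Q^{t-1}_sy^{t-1}_s),\qquad y^t_s=\mathcal P_{\Delta_{\mathcal B}}(\tilde y^{t-1}_s+\eta (Q^{t-1}_s)^\top x^{t-1}_s),$$ $$\tilde x^t_s=\mathcal P_{\Delta_{\mathcal A}}(\tilde x^{t-1}_s-\eta Q^{t}_sy^{t}_s),\qquad \tilde y^t_s=\mathcal P_{\Delta_{\mathcal B}}(\tilde y^{t-1}_s+\eta (Q^{t}_s)^\top x^{t}_s).$$ *Claim.* There are two real polynomials $p,q$ in four variables, independent of the game, such that every game as above has an error-bound constant, and for every error-bound constant $c_+$ of the game there are constants $c_0\in(0,1)$ and $\delta_0>0$, depending only on the game and on $c_+$, with the following properties. 1. $c_+^2\le c_0\cdot p(S,A,B,\tfrac1{1-\gamma})$, provided that not every policy pair lies in $\mathcal Z^*$; and $c_+^4\le\delta_0\cdot q(S,A,B,\tfrac1{1-\gamma})$. That is, $c_0=\Omega(c_+^2/\mathrm{poly}(S,A,B,\tfrac1{1-\gamma}))$ and $\delta_0=\Omega(c_+^4/\mathrm{poly}(S,A,B,\tfrac1{1-\gamma}))$.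 2. For every stepsize $0<\eta\le\dfrac{(1-\gamma)^{5/2}}{32\sqrt S\,(A+B)}$, every $T_1,T_2\in\mathbb N$ and every $\hat z\in\mathcal Z$ with $\mathrm{dist}^2(\hat z,\mathcal Z^*)\le\delta_0\eta^4$, the pairs $z^t$ played by OGDA on $[T_1:T_2]$ with initial pair $\hat z$ and stepsize $\eta$ satisfy, for all $t\in[T_1:T_2]$, $$\mathrm{dist}^2(z^t,\mathcal Z^*)\ \le\ \frac{8S}{1-\gamma}\Big(1-\frac{c_0\eta^2}{48}\Big)^{t-T_1}\mathrm{dist}^2(\hat z,\mathcal Z^*).$$ -/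

import Mathlib

noncomputable section

open scoped Matrix

/-- The probability simplex over `ι`, inside the Euclidean space `ℝ^ι`. -/
def probSimplex (ι : Type) [Fintype ι] : Set (EuclideanSpace ℝ ι) :=
  {p | (∀ i, 0 ≤ p i) ∧ ∑ i, p i = 1}

theorem probSimplex_nonempty (ι : Type) [Fintype ι] [Nonempty ι] :
    (probSimplex ι).Nonempty := by
  classical
  obtain ⟨i⟩ := ‹Nonempty ι›
  refine ⟨EuclideanSpace.single i 1, fun j => ?_, ?_⟩
  · by_cases h : j = i <;> simp [h]
  · simp

theorem probSimplex_isClosed (ι : Type) [Fintype ι] : IsClosed (probSimplex ι) := by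
  have h : probSimplex ι = (⋂ i, {p | 0 ≤ p i}) ∩ {p | ∑ i, p i = 1} := by
    ext p; simp [probSimplex]
  rw [h]
  refine IsClosed.inter (isClosed_iInter fun i => ?_) ?_
  · exact isClosed_le continuous_const (by fun_prop)
  · exact isClosed_eq (by fun_prop) continuous_const

/-- Euclidean projection of `v` onto `C`: a point of `C` nearest to `v` (the unique one if `C` is
nonempty, closed and convex; the value is `v` if there is no nearest point). -/
def nearestPoint {ι : Type} [Fintype ι] (C : Set (EuclideanSpace ℝ ι))
    (v : EuclideanSpace ℝ ι) : EuclideanSpace ℝ ι :=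
  open Classical in
  if h : ∃ p, p ∈ C ∧ ∀ q ∈ C, dist v p ≤ dist v q then h.choose else v

/-- The projection onto the probability simplex really is a nearest point. -/
theorem nearestPoint_probSimplex_spec {ι : Type} [Fintype ι] [Nonempty ι]
    (v : EuclideanSpace ℝ ι) :
    nearestPoint (probSimplex ι) v ∈ probSimplex ι ∧
      ∀ q ∈ probSimplex ι, dist v (nearestPoint (probSimplex ι) v) ≤ dist v q := by
  have h : ∃ p, p ∈ probSimplex ι ∧ ∀ q ∈ probSimplex ι, dist v p ≤ dist v q := by
    obtain ⟨p, hp, hd⟩ :=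
      (probSimplex_isClosed ι).exists_infDist_eq_dist (probSimplex_nonempty ι) v
    exact ⟨p, hp, fun q hq => hd ▸ Metric.infDist_le_dist_of_mem hq⟩
  rw [nearestPoint, dif_pos h]
  exact h.choose_spec

/-- A finite two-player zero-sum discounted Markov game with rewards in `[0, 1]`.  The min-player
acts in `A`, the max-player acts in `B`, and `trans s a b s'` is the probability of moving from
`s` to `s'` under the actions `a`, `b`. -/
structure MarkovGame (S A B : Type) [Fintype S] where
  trans : S → A → B → S → ℝ
  trans_nonneg : ∀ s a b s', 0 ≤ trans s a b s'
  trans_sum : ∀ s a b, ∑ s', trans s a b s' = 1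
  reward : S → Matrix A B ℝ
  reward_nonneg : ∀ s a b, 0 ≤ reward s a b
  reward_le_one : ∀ s a b, reward s a b ≤ 1
  disc : ℝ
  disc_nonneg : 0 ≤ disc
  disc_lt_one : disc < 1

/-- A vector `(x_s, y_s) ∈ ℝ^A × ℝ^B` with the Euclidean norm of `ℝ^(A + B)`. -/
abbrev LocalPair (A B : Type) [Fintype A] [Fintype B] : Type :=
  WithLp 2 (EuclideanSpace ℝ A × EuclideanSpace ℝ B)

/-- A vector `z = (z_s)_s` with `z_s = (x_s, y_s)`, with the Euclidean norm of `ℝ^((A + B) S)`. -/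
abbrev JointPair (S A B : Type) [Fintype S] [Fintype A] [Fintype B] : Type :=
  PiLp 2 (fun _ : S => LocalPair A B)

namespace MarkovGame

variable {S A B : Type} [Fintype S] [Fintype A] [Fintype B]

/-- The policies of one player (with action set `C`). -/
def policies (S C : Type) [Fintype C] : Set (S → EuclideanSpace ℝ C) :=
  {x | ∀ s, x s ∈ probSimplex C}

/-- The set `𝒵` of policy pairs. -/
def policyPairs (S A B : Type) [Fintype S] [Fintype A] [Fintype B] : Set (JointPair S A B) :=
  {z | ∀ s, (z s).fst ∈ probSimplex A ∧ (z s).snd ∈ probSimplex B}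

/-- The law of the state `s^t` of the Markovian trajectory that starts in `s₀` and in which
`a^t ∼ x_{s^t}`, `b^t ∼ y_{s^t}` independently and `s^{t+1} ∼ trans s^t a^t b^t`. -/
def stateLaw (G : MarkovGame S A B) (x : S → EuclideanSpace ℝ A) (y : S → EuclideanSpace ℝ B)
    (s₀ : S) : ℕ → S → ℝ
  | 0 => fun s => open Classical in if s = s₀ then 1 else 0
  | t + 1 => fun s' =>
      ∑ s, ∑ a, ∑ b, G.stateLaw x y s₀ t s * x s a * y s b * G.trans s a b s'

/-- The value `V^{x,y}(s₀)`: the expected discounted sum of the rewards along the trajectory that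
starts in `s₀`; the law of `(s^t, a^t, b^t)` is `stateLaw t s * x s a * y s b`. -/
def value (G : MarkovGame S A B) (x : S → EuclideanSpace ℝ A) (y : S → EuclideanSpace ℝ B)
    (s₀ : S) : ℝ :=
  ∑' t : ℕ, G.disc ^ t *
    ∑ s, ∑ a, ∑ b, G.stateLaw x y s₀ t s * x s a * y s b * G.reward s a b

/-- The Bellman target operator: `v ↦ Q_s[v]`. -/
def bellmanQ (G : MarkovGame S A B) (v : S → ℝ) (s : S) : Matrix A B ℝ :=
  Matrix.of fun a b => G.reward s a b + G.disc * ∑ s', G.trans s a b s' * v s'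

/-- The Q-function of a policy pair: `Q^{x,y}_s = Q_s[V^{x,y}]`. -/
def qFun (G : MarkovGame S A B) (x : S → EuclideanSpace ℝ A) (y : S → EuclideanSpace ℝ B)
    (s : S) : Matrix A B ℝ :=
  G.bellmanQ (G.value x y) s

/-- The minimax value `v*(s) = min_x max_y V^{x,y}(s)` over policies. -/
def gameValue (G : MarkovGame S A B) (s : S) : ℝ :=
  ⨅ x : policies S A, ⨆ y : policies S B, G.value x.1 y.1 s

/-- The minimax Q-function `Q*_s = Q_s[v*]`. -/
def qStar (G : MarkovGame S A B) (s : S) : Matrix A B ℝ :=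
  G.bellmanQ G.gameValue s

/-- `max_{y' ∈ Δ_B} xᵀ M y'`. -/
def maxPayoff (M : Matrix A B ℝ) (x : EuclideanSpace ℝ A) : ℝ :=
  ⨆ y : probSimplex B, x.ofLp ⬝ᵥ (M *ᵥ y.1.ofLp)

/-- `min_{x' ∈ Δ_A} x'ᵀ M y`. -/
def minPayoff (M : Matrix A B ℝ) (y : EuclideanSpace ℝ B) : ℝ :=
  ⨅ x : probSimplex A, x.1.ofLp ⬝ᵥ (M *ᵥ y.ofLp)

/-- `𝒳*_s = argmin_{x ∈ Δ_A} max_{y ∈ Δ_B} xᵀ Q*_s y`. -/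
def xStar (G : MarkovGame S A B) (s : S) : Set (EuclideanSpace ℝ A) :=
  {x | x ∈ probSimplex A ∧
    ∀ x' ∈ probSimplex A, maxPayoff (G.qStar s) x ≤ maxPayoff (G.qStar s) x'}

/-- `𝒴*_s = argmax_{y ∈ Δ_B} min_{x ∈ Δ_A} xᵀ Q*_s y`. -/
def yStar (G : MarkovGame S A B) (s : S) : Set (EuclideanSpace ℝ B) :=
  {y | y ∈ probSimplex B ∧
    ∀ y' ∈ probSimplex B, minPayoff (G.qStar s) y' ≤ minPayoff (G.qStar s) y}

/-- `𝒵*_s = 𝒳*_s × 𝒴*_s`. -/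
def zStarAt (G : MarkovGame S A B) (s : S) : Set (LocalPair A B) :=
  {w | w.fst ∈ G.xStar s ∧ w.snd ∈ G.yStar s}

/-- The Nash equilibrium set `𝒵* = ∏_s 𝒵*_s`. -/
def zStar (G : MarkovGame S A B) : Set (JointPair S A B) :=
  {z | ∀ s, z s ∈ G.zStarAt s}

/-- `c > 0` is a constant of the saddle-point error bound
`max_{y'} x_sᵀ Q*_s y' - min_{x'} x'ᵀ Q*_s y_s ≥ c · dist(z_s, 𝒵*_s)`. -/
def IsErrorBoundConst (G : MarkovGame S A B) (c : ℝ) : Prop :=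
  0 < c ∧ ∀ z ∈ policyPairs S A B, ∀ s,
    c * Metric.infDist (z s) (G.zStarAt s) ≤
      maxPayoff (G.qStar s) (z s).fst - minPayoff (G.qStar s) (z s).snd

/-- The policy gradient `Q^{x,y}_s y_s` of the min-player at the pair `z = (x, y)`. -/
def gradX (G : MarkovGame S A B) (z : JointPair S A B) (s : S) : EuclideanSpace ℝ A :=
  WithLp.toLp 2 (G.qFun (fun s => (z s).fst) (fun s => (z s).snd) s *ᵥ (z s).snd.ofLp)

/-- The policy gradient `(Q^{x,y}_s)ᵀ x_s` of the max-player at the pair `z = (x, y)`. -/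
def gradY (G : MarkovGame S A B) (z : JointPair S A B) (s : S) : EuclideanSpace ℝ B :=
  WithLp.toLp 2 ((G.qFun (fun s => (z s).fst) (fun s => (z s).snd) s)ᵀ *ᵥ (z s).fst.ofLp)

/-- `w = (x^+, y^+)` arises from `u` by one projected gradient descent/ascent step with stepsize
`η`, with the gradients taken at `z`. -/
def IsStep (G : MarkovGame S A B) (η : ℝ) (u z w : JointPair S A B) : Prop :=
  ∀ s,
    (w s).fst = nearestPoint (probSimplex A) ((u s).fst - η • G.gradX z s) ∧
    (w s).snd = nearestPoint (probSimplex B) ((u s).snd + η • G.gradY z s)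

/-- Independent optimistic policy gradient descent/ascent on the time interval `[T₁ : T₂]` with
initial pair `zhat` and stepsize `η`: `z t` are the pairs that are played, `zt t` the auxiliary
pairs. -/
def IsOGDA (G : MarkovGame S A B) (T₁ T₂ : ℕ) (zhat : JointPair S A B) (η : ℝ)
    (z zt : ℕ → JointPair S A B) : Prop :=
  z T₁ = zhat ∧ zt T₁ = zhat ∧
    ∀ t, T₁ ≤ t → t < T₂ →
      G.IsStep η (zt t) (z t) (z (t + 1)) ∧ G.IsStep η (zt t) (z (t + 1)) (zt (t + 1))

end MarkovGame

end

noncomputable section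

open scoped Matrix

set_option linter.unusedSectionVars false

/-! ### Error bounds on polytopes -/

/-! Write `H = 1/(1-γ)`, `N = A + B`, and let `F` be the gradient field `(Q y, -Qᵀ x)` with `Q =
Q^{x,y}`. The Lyapunov function `Θ = dist²(z̃, 𝒵*) + ‖z̃ - z‖²/2` of the auxiliary pair `z̃` and the
played pair `z` shrinks by the factor `1 - mη²/4` in every step that starts with `Θ ≤ (εη²)²`. Here
`m` is `c₊²` over a polynomial (`conditionRatio`) and `ε` is `m` over a polynomial (`localRadius`).
Contraction preserves this smallness, so the step can be iterated, and `dist²(z, 𝒵*) ≤ 4Θ` passes to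
the played pairs.

Three facts give the contraction. Let `z*` be the equilibrium nearest to the old auxiliary pair.

Descent (`optimistic_step_inequality`): the usual optimistic gradient inequality, whose error term
is absorbed because the stepsize makes `ηF` Lipschitz with constant 1/16 (`norm_field_sub_le`).

Approximate monotonicity (`relGap_sub_le_inner_field`): `Q` varies with the policies, so `⟨F(v), v -
z*⟩` may be negative. With `Q*` in place of `Q` it would equal a nonnegative gap `g`. A bilinear
expansion around the equilibrium shows that `Q - Q*` is of order `g + ‖v - z*‖²`. Hence the error is
of order `g‖v - z*‖ + ‖v - z*‖³`: near `𝒵*` the first term is at most half of `g`, and the second is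
of higher order than `Θ`. This is why the result is local.

Progress (`mul_infDist_zStarAt_le`): the optimality condition of the second projection bounds the
duality gap of the new auxiliary pair in `Q*` by the step lengths over `η` plus the same errors. The
error bound turns this into a bound on its distance to `𝒵*`, so the step lengths and `g`, which the
descent inequality provides with a favourable sign, dominate `mη² dist²`.

The error bound itself holds because the truncated epigraph of the duality gap is a polytope: it
suffices to check its finitely many extreme points (`exists_mul_infDist_le_of_polytope`). Shapley's
fixed point theorem identifies `v*` and makes `𝒵*_s` the saddle set of `Q*_s`. -/

/-- A polyhedron, given by finitely many affine inequalities on an affine subspace, has finitely many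
extreme points. -/
theorem finite_extremePoints_of_affine_inequalities {E ι : Type*} [AddCommGroup E] [Module ℝ E]
    [Finite ι] (L : Set E) (g : ι → E → ℝ)
    (hL : ∀ p ∈ L, ∀ q ∈ L, ∀ t : ℝ, (1 - t) • p + t • q ∈ L)
    (hg : ∀ i p q (t : ℝ), g i ((1 - t) • p + t • q) = (1 - t) * g i p + t * g i q) :
    ({p | p ∈ L ∧ ∀ i, g i p ≤ 0}.extremePoints ℝ).Finite := by
  -- An extreme point is determined by its set of active constraints. If `p` and `q` have the same
  -- set, the segment from `q` to `p` can be prolonged a little beyond `p` inside the polyhedron, so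
  -- extremality of `p` forces `p = q`.
  refine Set.Finite.of_finite_image (f := fun p => {i | g i p = 0}) (Set.toFinite _) ?_
  intro p hp q hq hpq
  have hpq' : ∀ i, g i p = 0 ↔ g i q = 0 := fun i => Set.ext_iff.1 hpq i
  obtain ⟨⟨hpL, hp0⟩, hpe⟩ := hp
  obtain ⟨⟨hqL, hq0⟩, -⟩ := hq
  have hev : ∀ᶠ t : ℝ in nhdsWithin 0 (Set.Ioi 0), ∀ i, (1 + t) * g i p - t * g i q ≤ 0 := by
    rw [Filter.eventually_all]
    intro i
    by_cases h : g i p = 0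
    · simp [h, (hpq' i).1 h]
    · have hneg : g i p < 0 := lt_of_le_of_ne (hp0 i) h
      have hc : Continuous fun t : ℝ => (1 + t) * g i p - t * g i q := by fun_prop
      have : ∀ᶠ t in nhds (0 : ℝ), (1 + t) * g i p - t * g i q < 0 :=
        hc.continuousAt.eventually_lt_const (by simpa using hneg)
      exact (this.filter_mono nhdsWithin_le_nhds).mono fun t ht => ht.le
  obtain ⟨t, ht, ht0⟩ := (hev.and self_mem_nhdsWithin).exists
  have ht0 : (0 : ℝ) < t := ht0
  have h1 : (1 - (-t)) • p + (-t) • q ∈ {p | p ∈ L ∧ ∀ i, g i p ≤ 0} := by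
    refine ⟨hL p hpL q hqL _, fun i => ?_⟩
    rw [hg]
    have := ht i
    linarith
  have h2 := hpe (x₁ := q) ⟨hqL, hq0⟩ h1 ?_
  · exact h2.symm
  · refine ⟨t / (1 + t), 1 / (1 + t), by positivity, by positivity, by field_simp; ring, ?_⟩
    have hne : 1 + t ≠ 0 := by positivity
    rw [smul_add, smul_smul, smul_smul]
    have e1 : 1 / (1 + t) * (1 - -t) = 1 := by field_simp; ring
    have e2 : 1 / (1 + t) * -t = -(t / (1 + t)) := by field_simp
    rw [e1, e2, one_smul, neg_smul]
    abel

theorem convexOn_infDist {E : Type*} [NormedAddCommGroup E] [NormedSpace ℝ E] {Z : Set E}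
    (hZ : Convex ℝ Z) (hne : Z.Nonempty) :
    ConvexOn ℝ Set.univ fun p => Metric.infDist p Z := by
  refine ⟨convex_univ, fun p _ q _ a b ha hb hab => ?_⟩
  refine le_of_forall_pos_le_add fun ε hε => ?_
  obtain ⟨p', hp', hpd⟩ :=
    (Metric.infDist_lt_iff (r := Metric.infDist p Z + ε) hne).1 (lt_add_of_pos_right _ hε)
  obtain ⟨q', hq', hqd⟩ :=
    (Metric.infDist_lt_iff (r := Metric.infDist q Z + ε) hne).1 (lt_add_of_pos_right _ hε)
  calc Metric.infDist (a • p + b • q) Z ≤ dist (a • p + b • q) (a • p' + b • q') :=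
        Metric.infDist_le_dist_of_mem (hZ hp' hq' ha hb hab)
    _ ≤ a * dist p p' + b * dist q q' := by
        refine (dist_add_add_le _ _ _ _).trans (le_of_eq ?_)
        rw [dist_smul₀, dist_smul₀, Real.norm_of_nonneg ha, Real.norm_of_nonneg hb]
    _ ≤ a * (Metric.infDist p Z + ε) + b * (Metric.infDist q Z + ε) := by gcongr
    _ = a • Metric.infDist p Z + b • Metric.infDist q Z + ε := by
        simp only [smul_eq_mul]
        linear_combination ε * hab

/-- On a polytope in `E × ℝ` on which the last coordinate is nonnegative, that coordinate bounds the
distance to its zero set from above, up to a constant. -/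
theorem exists_mul_infDist_le_of_polytope {E ι : Type*} [NormedAddCommGroup E] [NormedSpace ℝ E]
    [Finite ι] (L : Set (E × ℝ)) (g : ι → E × ℝ → ℝ)
    (hL : ∀ p ∈ L, ∀ q ∈ L, ∀ t : ℝ, (1 - t) • p + t • q ∈ L)
    (hg : ∀ i p q (t : ℝ), g i ((1 - t) • p + t • q) = (1 - t) * g i p + t * g i q)
    (hK : IsCompact {p | p ∈ L ∧ ∀ i, g i p ≤ 0})
    (hnn : ∀ p ∈ L, (∀ i, g i p ≤ 0) → 0 ≤ p.2)
    {Z : Set E} (hZ : Convex ℝ Z) (hne : Z.Nonempty)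
    (hz : ∀ p ∈ L, (∀ i, g i p ≤ 0) → p.2 = 0 → p.1 ∈ Z) :
    ∃ c : ℝ, 0 < c ∧ ∀ p ∈ L, (∀ i, g i p ≤ 0) → c * Metric.infDist p.1 Z ≤ p.2 := by
  set K : Set (E × ℝ) := {p | p ∈ L ∧ ∀ i, g i p ≤ 0} with hKdef
  have hKc : Convex ℝ K := by
    rintro p ⟨hpL, hp⟩ q ⟨hqL, hq⟩ a b ha hb hab
    obtain rfl : a = 1 - b := by linarith
    refine ⟨hL p hpL q hqL b, fun i => ?_⟩
    rw [hg]
    nlinarith [mul_nonneg ha (neg_nonneg.2 (hp i)), mul_nonneg hb (neg_nonneg.2 (hq i))]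
  have hfin : (K.extremePoints ℝ).Finite := finite_extremePoints_of_affine_inequalities L g hL hg
  -- A single point always admits a constant: if its last coordinate vanishes, so does its distance
  -- to `Z`. Finitely many extreme points then share one.
  have hex : ∀ p ∈ K, ∃ c : ℝ, 0 < c ∧ c * Metric.infDist p.1 Z ≤ p.2 := by
    rintro p ⟨hpL, hp⟩
    rcases (hnn p hpL hp).eq_or_lt with h | h
    · exact ⟨1, one_pos, by rw [Metric.infDist_zero_of_mem (hz p hpL hp h.symm), ← h]; simp⟩
    · have h0 : 0 ≤ Metric.infDist p.1 Z := Metric.infDist_nonneg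
      refine ⟨p.2 / (Metric.infDist p.1 Z + 1), by positivity, ?_⟩
      rw [div_mul_eq_mul_div, div_le_iff₀ (by positivity)]
      nlinarith
  have hc : ∃ c : ℝ, 0 < c ∧ ∀ p ∈ K.extremePoints ℝ, c * Metric.infDist p.1 Z ≤ p.2 := by
    have key : ∀ T : Set (E × ℝ), T.Finite → T ⊆ K →
        ∃ c : ℝ, 0 < c ∧ ∀ p ∈ T, c * Metric.infDist p.1 Z ≤ p.2 := by
      intro T hT
      induction T, hT using Set.Finite.induction_on with
      | empty => exact fun _ => ⟨1, one_pos, by simp⟩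
      | @insert p T _ _ ih =>
        intro hTK
        obtain ⟨c, hc, hcT⟩ := ih ((Set.subset_insert _ _).trans hTK)
        obtain ⟨c', hc', hcp⟩ := hex p (hTK (Set.mem_insert _ _))
        refine ⟨min c c', lt_min hc hc', fun q hq => ?_⟩
        have h0 : 0 ≤ Metric.infDist q.1 Z := Metric.infDist_nonneg
        rcases hq with rfl | hq
        · exact (mul_le_mul_of_nonneg_right (min_le_right _ _) h0).trans hcp
        · exact (mul_le_mul_of_nonneg_right (min_le_left _ _) h0).trans (hcT q hq)
    exact key _ hfin extremePoints_subset
  obtain ⟨c, hc, hcp⟩ := hc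
  refine ⟨c, hc, fun p hpL hp => ?_⟩
  -- The inequality cuts out a closed set, convex because the distance to a convex set is convex.
  -- Containing the extreme points, it contains `K` by Krein–Milman.
  have hcl : IsClosed {p : E × ℝ | c * Metric.infDist p.1 Z ≤ p.2} :=
    isClosed_le (continuous_const.mul ((Metric.continuous_infDist_pt Z).comp continuous_fst))
      continuous_snd
  have hcv : Convex ℝ {p : E × ℝ | c * Metric.infDist p.1 Z ≤ p.2} := by
    intro p hp q hq a b ha hb hab
    have h := (convexOn_infDist hZ hne).2 (Set.mem_univ p.1) (Set.mem_univ q.1) ha hb hab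
    have hp : c * Metric.infDist p.1 Z ≤ p.2 := hp
    have hq : c * Metric.infDist q.1 Z ≤ q.2 := hq
    simp only [smul_eq_mul] at h
    change c * Metric.infDist (a • p.1 + b • q.1) Z ≤ a * p.2 + b * q.2
    nlinarith [mul_le_mul_of_nonneg_left hp ha, mul_le_mul_of_nonneg_left hq hb,
      mul_le_mul_of_nonneg_left h hc.le]
  have hsub : K ⊆ {p : E × ℝ | c * Metric.infDist p.1 Z ≤ p.2} := by
    rw [← closure_convexHull_extremePoints hK hKc]
    exact closure_minimal (convexHull_min hcp hcv) hcl
  exact hsub ⟨hpL, hp⟩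

/-! ### Projections and the extragradient inequality -/

theorem inner_sub_nonpos_of_forall_dist_le {E : Type*} [NormedAddCommGroup E]
    [InnerProductSpace ℝ E] {K : Set E} (hK : Convex ℝ K) {u v : E} (hv : v ∈ K)
    (h : ∀ q ∈ K, dist u v ≤ dist u q) : ∀ q ∈ K, inner ℝ (u - v) (q - v) ≤ 0 := by
  rw [← norm_eq_iInf_iff_real_inner_le_zero hK hv]
  have : Nonempty K := ⟨⟨v, hv⟩⟩
  refine le_antisymm (le_ciInf fun w => ?_) (ciInf_le ⟨0, ?_⟩ (⟨v, hv⟩ : K))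
  · simpa [dist_eq_norm] using h w w.2
  · rintro _ ⟨w, rfl⟩
    exact norm_nonneg _

section Hilbert

variable {E : Type*} [NormedAddCommGroup E] [InnerProductSpace ℝ E]

/-- Two projected steps from `w` with the gradients `f` and `f'` end at points whose distance is at
most `η ‖f' - f‖`. -/
theorem norm_sub_le_of_projected_steps {η : ℝ} {w f f' v w' : E} (hη : 0 ≤ η)
    (hv : inner ℝ (w - η • f - v) (w' - v) ≤ 0)
    (hw' : inner ℝ (w - η • f' - w') (v - w') ≤ 0) :
    ‖v - w'‖ ≤ η * ‖f' - f‖ := by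
  -- This is the sum of the two variational inequalities.
  have h : inner ℝ (v - w') (v - w') ≤ η * inner ℝ (f' - f) (v - w') := by
    have e : inner ℝ (v - w') (v - w') - η * inner ℝ (f' - f) (v - w') =
        inner ℝ (w - η • f - v) (w' - v) + inner ℝ (w - η • f' - w') (v - w') := by
      rw [← neg_sub v w', inner_neg_right, ← sub_eq_neg_add, ← inner_sub_left,
        ← real_inner_smul_left, ← inner_sub_left]
      congr 1
      module
    linarith
  rw [real_inner_self_eq_norm_sq] at h
  have h2 := mul_le_mul_of_nonneg_left (real_inner_le_norm (f' - f) (v - w')) hη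
  rcases (norm_nonneg (v - w')).eq_or_lt with h0 | h0
  · rw [← h0]; positivity
  · nlinarith

/-- The basic inequality of one optimistic gradient step. -/
theorem optimistic_step_inequality {η : ℝ} {w f f' v w' z : E} (hη : 0 ≤ η)
    (hv : inner ℝ (w - η • f - v) (w' - v) ≤ 0)
    (hw'v : inner ℝ (w - η • f' - w') (v - w') ≤ 0)
    (hw'z : inner ℝ (w - η • f' - w') (z - w') ≤ 0) :
    ‖w' - z‖ ^ 2 + ‖w' - v‖ ^ 2 + ‖v - w‖ ^ 2 + 2 * η * inner ℝ f' (v - z) ≤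
      ‖w - z‖ ^ 2 + 2 * (η * ‖f' - f‖) ^ 2 := by
  have h1 := norm_sub_le_of_projected_steps hη hv hw'v
  have h2 : inner ℝ (f' - f) (v - w') ≤ ‖f' - f‖ * ‖v - w'‖ := real_inner_le_norm _ _
  have h3 : η * inner ℝ (f' - f) (v - w') ≤ (η * ‖f' - f‖) ^ 2 := by
    have := norm_nonneg (f' - f)
    calc η * inner ℝ (f' - f) (v - w') ≤ η * (‖f' - f‖ * (η * ‖f' - f‖)) := by
          gcongr
          exact h2.trans (by gcongr)
      _ = (η * ‖f' - f‖) ^ 2 := by ring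
  -- Of the three terms on the right only the last may be positive. It is the price of having
  -- reached `v` with the old gradient `f` instead of `f'`.
  have key : ‖w' - z‖ ^ 2 + ‖w' - v‖ ^ 2 + ‖v - w‖ ^ 2 + 2 * η * inner ℝ f' (v - z) - ‖w - z‖ ^ 2 =
      2 * inner ℝ (w - η • f - v) (w' - v) + 2 * inner ℝ (w - η • f' - w') (z - w')
        + 2 * (η * inner ℝ (f' - f) (v - w')) := by
    simp only [← real_inner_self_eq_norm_sq, inner_sub_left, inner_sub_right,
      real_inner_smul_left]
    rw [real_inner_comm w' w, real_inner_comm w z, real_inner_comm w v, real_inner_comm w' z,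
      real_inner_comm w' v]
    ring
  linarith

end Hilbert

/-! ### Matrix games -/

theorem convex_probSimplex (ι : Type) [Fintype ι] : Convex ℝ (probSimplex ι) := by
  rintro p ⟨hp, hp1⟩ q ⟨hq, hq1⟩ a b ha hb hab
  refine ⟨fun i => ?_, ?_⟩
  · simpa using add_nonneg (mul_nonneg ha (hp i)) (mul_nonneg hb (hq i))
  · simp [Finset.sum_add_distrib, ← Finset.mul_sum, hp1, hq1, hab]

theorem single_mem_probSimplex {ι : Type} [Fintype ι] [DecidableEq ι] (i : ι) :
    EuclideanSpace.single i (1 : ℝ) ∈ probSimplex ι := by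
  refine ⟨fun j => ?_, by simp⟩
  by_cases h : j = i <;> simp [h]

theorem sum_abs_of_mem_probSimplex {ι : Type} [Fintype ι] {x : EuclideanSpace ℝ ι}
    (hx : x ∈ probSimplex ι) : ∑ i, |x i| = 1 := by
  rw [← hx.2]
  exact Finset.sum_congr rfl fun i _ => abs_of_nonneg (hx.1 i)

theorem norm_sq_le_one_of_mem_probSimplex {ι : Type} [Fintype ι] {x : EuclideanSpace ℝ ι}
    (hx : x ∈ probSimplex ι) : ‖x‖ ^ 2 ≤ 1 := by
  rw [EuclideanSpace.norm_sq_eq, ← hx.2]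
  refine Finset.sum_le_sum fun i _ => ?_
  have h1 : x i ≤ 1 := by
    rw [← hx.2]
    exact Finset.single_le_sum (fun j _ => hx.1 j) (Finset.mem_univ i)
  rw [Real.norm_of_nonneg (hx.1 i)]
  nlinarith [hx.1 i]

theorem norm_sub_sq_le_of_mem_probSimplex {ι : Type} [Fintype ι] {x y : EuclideanSpace ℝ ι}
    (hx : x ∈ probSimplex ι) (hy : y ∈ probSimplex ι) : ‖x - y‖ ^ 2 ≤ 2 := by
  have h : 0 ≤ inner ℝ x y := by
    rw [PiLp.inner_apply]
    exact Finset.sum_nonneg fun i _ => by simpa using mul_nonneg (hy.1 i) (hx.1 i)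
  rw [norm_sub_sq_real]
  linarith [norm_sq_le_one_of_mem_probSimplex hx, norm_sq_le_one_of_mem_probSimplex hy]

theorem isCompact_probSimplex (ι : Type) [Fintype ι] : IsCompact (probSimplex ι) := by
  refine Metric.isCompact_of_isClosed_isBounded (probSimplex_isClosed ι) ?_
  refine (Metric.isBounded_closedBall (x := (0 : EuclideanSpace ℝ ι)) (r := 1)).subset
    fun x hx => ?_
  have := norm_sq_le_one_of_mem_probSimplex hx
  rw [mem_closedBall_zero_iff]
  nlinarith [norm_nonneg x]

namespace MarkovGame

variable {A B : Type} [Fintype A] [Fintype B]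

/-- The payoff `xᵀ M y`. -/
def payoff (M : Matrix A B ℝ) (x : EuclideanSpace ℝ A) (y : EuclideanSpace ℝ B) : ℝ :=
  x.ofLp ⬝ᵥ (M *ᵥ y.ofLp)

/-- The `ℓ¹` norm of a local pair. -/
def l1Norm (w : LocalPair A B) : ℝ :=
  ∑ a, |w.fst a| + ∑ b, |w.snd b|

theorem l1Norm_nonneg (w : LocalPair A B) : 0 ≤ l1Norm w := by
  unfold l1Norm
  positivity

theorem l1Norm_sq_le (w : LocalPair A B) :
    l1Norm w ^ 2 ≤ ((Fintype.card A : ℝ) + Fintype.card B) * ‖w‖ ^ 2 := by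
  have h := sq_sum_le_card_mul_sum_sq (s := (Finset.univ : Finset (A ⊕ B)))
    (f := Sum.elim (fun a => |w.fst a|) fun b => |w.snd b|)
  rw [WithLp.prod_norm_sq_eq_of_L2, EuclideanSpace.norm_sq_eq, EuclideanSpace.norm_sq_eq]
  simpa [l1Norm] using h

theorem payoff_eq_sum (M : Matrix A B ℝ) (x : EuclideanSpace ℝ A) (y : EuclideanSpace ℝ B) :
    payoff M x y = ∑ a, ∑ b, x a * M a b * y b := by
  simp [payoff, dotProduct, Matrix.mulVec, Finset.mul_sum, mul_assoc]

theorem payoff_add_left (M : Matrix A B ℝ) (x x' : EuclideanSpace ℝ A)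
    (y : EuclideanSpace ℝ B) : payoff M (x + x') y = payoff M x y + payoff M x' y := by
  simp [payoff, add_dotProduct]

theorem payoff_sub_left (M : Matrix A B ℝ) (x x' : EuclideanSpace ℝ A)
    (y : EuclideanSpace ℝ B) : payoff M (x - x') y = payoff M x y - payoff M x' y := by
  simp [payoff, sub_dotProduct]

theorem payoff_smul_left (M : Matrix A B ℝ) (t : ℝ) (x : EuclideanSpace ℝ A)
    (y : EuclideanSpace ℝ B) : payoff M (t • x) y = t * payoff M x y := by
  simp [payoff]

theorem payoff_add_right (M : Matrix A B ℝ) (x : EuclideanSpace ℝ A)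
    (y y' : EuclideanSpace ℝ B) : payoff M x (y + y') = payoff M x y + payoff M x y' := by
  simp [payoff, Matrix.mulVec_add, dotProduct_add]

theorem payoff_sub_right (M : Matrix A B ℝ) (x : EuclideanSpace ℝ A)
    (y y' : EuclideanSpace ℝ B) : payoff M x (y - y') = payoff M x y - payoff M x y' := by
  simp [payoff, Matrix.mulVec_sub, dotProduct_sub]

theorem payoff_smul_right (M : Matrix A B ℝ) (t : ℝ) (x : EuclideanSpace ℝ A)
    (y : EuclideanSpace ℝ B) : payoff M x (t • y) = t * payoff M x y := by
  simp [payoff, Matrix.mulVec_smul]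

theorem payoff_sub_matrix (M M' : Matrix A B ℝ) (x : EuclideanSpace ℝ A)
    (y : EuclideanSpace ℝ B) : payoff (M - M') x y = payoff M x y - payoff M' x y := by
  simp [payoff, Matrix.sub_mulVec, dotProduct_sub]

theorem continuous_payoff_left (M : Matrix A B ℝ) (y : EuclideanSpace ℝ B) :
    Continuous fun x => payoff M x y := by
  simp only [payoff_eq_sum]
  fun_prop

theorem continuous_payoff_right (M : Matrix A B ℝ) (x : EuclideanSpace ℝ A) :
    Continuous fun y => payoff M x y := by
  simp only [payoff_eq_sum]
  fun_prop

theorem abs_payoff_le {M : Matrix A B ℝ} {m : ℝ} (hM : ∀ a b, |M a b| ≤ m)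
    (x : EuclideanSpace ℝ A) (y : EuclideanSpace ℝ B) :
    |payoff M x y| ≤ m * (∑ a, |x a|) * ∑ b, |y b| := by
  rw [payoff_eq_sum, mul_assoc, Finset.sum_mul_sum, Finset.mul_sum]
  refine (Finset.abs_sum_le_sum_abs _ _).trans (Finset.sum_le_sum fun a _ => ?_)
  rw [Finset.mul_sum]
  refine (Finset.abs_sum_le_sum_abs _ _).trans (Finset.sum_le_sum fun b _ => ?_)
  rw [abs_mul, abs_mul]
  have := mul_le_mul_of_nonneg_left (hM a b) (mul_nonneg (abs_nonneg (x a)) (abs_nonneg (y b)))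
  linarith

theorem abs_payoff_le_of_mem {M : Matrix A B ℝ} {m : ℝ} (hM : ∀ a b, |M a b| ≤ m)
    {x : EuclideanSpace ℝ A} {y : EuclideanSpace ℝ B} (hx : x ∈ probSimplex A)
    (hy : y ∈ probSimplex B) : |payoff M x y| ≤ m := by
  simpa [sum_abs_of_mem_probSimplex hx, sum_abs_of_mem_probSimplex hy] using abs_payoff_le hM x y

theorem payoff_const (v : ℝ) {x : EuclideanSpace ℝ A} {y : EuclideanSpace ℝ B}
    (hx : x ∈ probSimplex A) (hy : y ∈ probSimplex B) :
    payoff (Matrix.of fun _ _ => v) x y = v := by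
  simp_rw [payoff_eq_sum, Matrix.of_apply, ← Finset.mul_sum, hy.2, ← Finset.sum_mul, hx.2]
  ring

theorem payoff_mono {M M' : Matrix A B ℝ} (h : ∀ a b, M a b ≤ M' a b)
    {x : EuclideanSpace ℝ A} {y : EuclideanSpace ℝ B}
    (hx : x ∈ probSimplex A) (hy : y ∈ probSimplex B) : payoff M x y ≤ payoff M' x y := by
  rw [payoff_eq_sum, payoff_eq_sum]
  refine Finset.sum_le_sum fun a _ => Finset.sum_le_sum fun b _ => ?_
  have := mul_le_mul_of_nonneg_left (h a b) (mul_nonneg (hx.1 a) (hy.1 b))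
  linarith

/-- The left side is the average, with weights `x' a * y' b`, of the same expression at pure
actions. This reduces a bound on the duality gap to finitely many affine inequalities. -/
theorem payoff_le_of_forall_single [DecidableEq A] [DecidableEq B] {M : Matrix A B ℝ}
    {x : EuclideanSpace ℝ A} {y : EuclideanSpace ℝ B} {r : ℝ}
    (h : ∀ a b, payoff M x (EuclideanSpace.single b 1) -
      payoff M (EuclideanSpace.single a 1) y ≤ r)
    {x' : EuclideanSpace ℝ A} {y' : EuclideanSpace ℝ B} (hx' : x' ∈ probSimplex A)
    (hy' : y' ∈ probSimplex B) : payoff M x y' - payoff M x' y ≤ r := by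
  have e1 : payoff M x y' = payoff
      (Matrix.of fun (_ : A) b => payoff M x (EuclideanSpace.single b 1)) x' y' := by
    have : ∀ b, payoff M x (EuclideanSpace.single b 1) = ∑ a, x a * M a b := fun b => by
      simp [payoff_eq_sum]
    simp_rw [this, payoff_eq_sum, Matrix.of_apply, mul_assoc, ← Finset.mul_sum,
      ← Finset.sum_mul, hx'.2, one_mul, Finset.sum_mul]
    rw [Finset.sum_comm]
    simp [Finset.mul_sum, mul_assoc]
  have e2 : payoff M x' y = payoff
      (Matrix.of fun a (_ : B) => payoff M (EuclideanSpace.single a 1) y) x' y' := by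
    have : ∀ a, payoff M (EuclideanSpace.single a 1) y = ∑ b, M a b * y b := fun a => by
      simp [payoff_eq_sum]
    simp_rw [this, payoff_eq_sum, Matrix.of_apply, ← Finset.mul_sum, hy'.2, mul_one,
      Finset.mul_sum, mul_assoc]
  rw [e1, e2, ← payoff_sub_matrix, ← payoff_const r hx' hy']
  exact payoff_mono (fun a b => h a b) hx' hy'

/-- `(x, y)` is a pair of optimal strategies in the matrix game `M`, whose value is `v`. -/
def IsSaddle (M : Matrix A B ℝ) (v : ℝ) (x : EuclideanSpace ℝ A) (y : EuclideanSpace ℝ B) : Prop :=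
  x ∈ probSimplex A ∧ y ∈ probSimplex B ∧ (∀ y' ∈ probSimplex B, payoff M x y' ≤ v) ∧
    ∀ x' ∈ probSimplex A, v ≤ payoff M x' y

theorem exists_isSaddle [Nonempty A] [Nonempty B] (M : Matrix A B ℝ) :
    ∃ v x y, IsSaddle M v x y := by
  obtain ⟨x, hx, y, hy, h⟩ := Sion.exists_isSaddlePointOn (f := payoff M)
    (probSimplex_nonempty A) (convex_probSimplex A) (isCompact_probSimplex A)
    (fun y _ => (continuous_payoff_left M y).lowerSemicontinuous.lowerSemicontinuousOn _)
    (fun y _ => ConvexOn.quasiconvexOn ⟨convex_probSimplex A, fun p _ q _ a b _ _ _ => by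
      simp [payoff_add_left, payoff_smul_left]⟩)
    (convex_probSimplex B) (probSimplex_nonempty B) (isCompact_probSimplex B)
    (fun x _ => (continuous_payoff_right M x).upperSemicontinuous.upperSemicontinuousOn _)
    (fun x _ => ConcaveOn.quasiconcaveOn ⟨convex_probSimplex B, fun p _ q _ a b _ _ _ => by
      simp [payoff_add_right, payoff_smul_right]⟩)
  exact ⟨payoff M x y, x, y, hx, hy, fun y' hy' => h x hx y' hy', fun x' hx' => h x' hx' y hy⟩

theorem exists_abs_le (M : Matrix A B ℝ) : ∃ m, 0 ≤ m ∧ ∀ a b, |M a b| ≤ m := by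
  refine ⟨∑ a, ∑ b, |M a b|, by positivity, fun a b => ?_⟩
  exact (Finset.single_le_sum (f := fun b => |M a b|) (fun _ _ => abs_nonneg _)
    (Finset.mem_univ b)).trans (Finset.single_le_sum (f := fun a => ∑ b, |M a b|)
      (fun _ _ => by positivity) (Finset.mem_univ a))

theorem payoff_le_maxPayoff (M : Matrix A B ℝ) (x : EuclideanSpace ℝ A)
    {y : EuclideanSpace ℝ B} (hy : y ∈ probSimplex B) : payoff M x y ≤ maxPayoff M x := by
  obtain ⟨m, -, hm⟩ := exists_abs_le M
  refine le_ciSup (f := fun y : probSimplex B => payoff M x y) ⟨m * (∑ a, |x a|) * 1, ?_⟩ ⟨y, hy⟩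
  rintro _ ⟨y', rfl⟩
  have := (le_abs_self _).trans (abs_payoff_le hm x y'.1)
  rwa [sum_abs_of_mem_probSimplex y'.2] at this

theorem minPayoff_le_payoff (M : Matrix A B ℝ) {x : EuclideanSpace ℝ A}
    (y : EuclideanSpace ℝ B) (hx : x ∈ probSimplex A) : minPayoff M y ≤ payoff M x y := by
  obtain ⟨m, -, hm⟩ := exists_abs_le M
  refine ciInf_le (f := fun x : probSimplex A => payoff M x y)
    ⟨-(m * 1 * ∑ b, |y b|), ?_⟩ ⟨x, hx⟩
  rintro _ ⟨x', rfl⟩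
  have := neg_le_of_abs_le (abs_payoff_le hm x'.1 y)
  rwa [sum_abs_of_mem_probSimplex x'.2] at this

theorem maxPayoff_le [Nonempty B] {M : Matrix A B ℝ} {x : EuclideanSpace ℝ A} {r : ℝ}
    (h : ∀ y ∈ probSimplex B, payoff M x y ≤ r) : maxPayoff M x ≤ r := by
  have : Nonempty (probSimplex B) := (probSimplex_nonempty B).to_subtype
  exact ciSup_le fun y => h y.1 y.2

theorem le_minPayoff [Nonempty A] {M : Matrix A B ℝ} {y : EuclideanSpace ℝ B} {r : ℝ}
    (h : ∀ x ∈ probSimplex A, r ≤ payoff M x y) : r ≤ minPayoff M y := by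
  have : Nonempty (probSimplex A) := (probSimplex_nonempty A).to_subtype
  exact le_ciInf fun x => h x.1 x.2

/-- The pairs of minimax and maximin strategies are the saddle points. -/
theorem isSaddle_iff_of_isSaddle [Nonempty A] [Nonempty B] {M : Matrix A B ℝ} {v : ℝ}
    {x₀ : EuclideanSpace ℝ A} {y₀ : EuclideanSpace ℝ B} (h₀ : IsSaddle M v x₀ y₀)
    (x : EuclideanSpace ℝ A) (y : EuclideanSpace ℝ B) :
    IsSaddle M v x y ↔
      (x ∈ probSimplex A ∧ ∀ x' ∈ probSimplex A, maxPayoff M x ≤ maxPayoff M x') ∧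
      (y ∈ probSimplex B ∧ ∀ y' ∈ probSimplex B, minPayoff M y' ≤ minPayoff M y) := by
  obtain ⟨hx₀, hy₀, hx₀v, hy₀v⟩ := h₀
  constructor
  · rintro ⟨hx, hy, hxv, hyv⟩
    refine ⟨⟨hx, fun x' hx' => ?_⟩, ⟨hy, fun y' hy' => ?_⟩⟩
    · exact (maxPayoff_le hxv).trans ((hy₀v x' hx').trans (payoff_le_maxPayoff M x' hy₀))
    · exact ((minPayoff_le_payoff M y' hx₀).trans (hx₀v y' hy')).trans (le_minPayoff hyv)
  · rintro ⟨⟨hx, hxm⟩, ⟨hy, hym⟩⟩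
    refine ⟨hx, hy, fun y' hy' => ?_, fun x' hx' => ?_⟩
    · exact (payoff_le_maxPayoff M x hy').trans ((hxm x₀ hx₀).trans (maxPayoff_le hx₀v))
    · exact ((le_minPayoff hy₀v).trans (hym y₀ hy₀)).trans (minPayoff_le_payoff M y hx')

theorem convex_setOf_isSaddle (M : Matrix A B ℝ) (v : ℝ) :
    Convex ℝ {w : LocalPair A B | IsSaddle M v w.fst w.snd} := by
  rintro p ⟨hp1, hp2, hp3, hp4⟩ q ⟨hq1, hq2, hq3, hq4⟩ a b ha hb hab
  refine ⟨convex_probSimplex A hp1 hq1 ha hb hab, convex_probSimplex B hp2 hq2 ha hb hab,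
    fun y' hy' => ?_, fun x' hx' => ?_⟩
  · change payoff M (a • p.fst + b • q.fst) y' ≤ v
    rw [payoff_add_left, payoff_smul_left, payoff_smul_left]
    have h1 := mul_le_mul_of_nonneg_left (hp3 y' hy') ha
    have h2 := mul_le_mul_of_nonneg_left (hq3 y' hy') hb
    have h3 : a * v + b * v = v := by rw [← add_mul, hab, one_mul]
    linarith
  · change v ≤ payoff M x' (a • p.snd + b • q.snd)
    rw [payoff_add_right, payoff_smul_right, payoff_smul_right]
    have h1 := mul_le_mul_of_nonneg_left (hp4 x' hx') ha
    have h2 := mul_le_mul_of_nonneg_left (hq4 x' hx') hb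
    have h3 : a * v + b * v = v := by rw [← add_mul, hab, one_mul]
    linarith

theorem continuous_localPair_fst : Continuous fun w : LocalPair A B => w.fst :=
  by fun_prop

theorem continuous_localPair_snd : Continuous fun w : LocalPair A B => w.snd :=
  by fun_prop

theorem isClosed_setOf_isSaddle (M : Matrix A B ℝ) (v : ℝ) :
    IsClosed {w : LocalPair A B | IsSaddle M v w.fst w.snd} := by
  simp only [IsSaddle, Set.ofPred_and, Set.ofPred_forall]
  refine ((probSimplex_isClosed A).preimage continuous_localPair_fst).inter
    (((probSimplex_isClosed B).preimage continuous_localPair_snd).inter (IsClosed.inter ?_ ?_))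
  · exact isClosed_iInter fun y' => isClosed_iInter fun _ =>
      isClosed_le ((continuous_payoff_left M y').comp continuous_localPair_fst) continuous_const
  · exact isClosed_iInter fun x' => isClosed_iInter fun _ =>
      isClosed_le continuous_const ((continuous_payoff_right M x').comp continuous_localPair_snd)

theorem norm_le_two_of_mem {w : LocalPair A B} (h1 : w.fst ∈ probSimplex A)
    (h2 : w.snd ∈ probSimplex B) : ‖w‖ ≤ 2 := by
  have := WithLp.prod_norm_sq_eq_of_L2 w
  nlinarith [norm_sq_le_one_of_mem_probSimplex h1, norm_sq_le_one_of_mem_probSimplex h2,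
    norm_nonneg w]

theorem norm_sub_le_two_of_mem {w w' : LocalPair A B} (h1 : w.fst ∈ probSimplex A)
    (h2 : w.snd ∈ probSimplex B) (h1' : w'.fst ∈ probSimplex A)
    (h2' : w'.snd ∈ probSimplex B) : ‖w - w'‖ ≤ 2 := by
  have := WithLp.prod_norm_sq_eq_of_L2 (w - w')
  have e1 : (w - w').fst = w.fst - w'.fst := rfl
  have e2 : (w - w').snd = w.snd - w'.snd := rfl
  rw [e1, e2] at this
  nlinarith [norm_sub_sq_le_of_mem_probSimplex h1 h1', norm_sub_sq_le_of_mem_probSimplex h2 h2',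
    norm_nonneg (w - w')]

theorem fst_affine_combination (p q : LocalPair A B × ℝ) (s t : ℝ) :
    (s • p + t • q).1.fst = s • p.1.fst + t • q.1.fst := rfl

theorem snd_affine_combination (p q : LocalPair A B × ℝ) (s t : ℝ) :
    (s • p + t • q).1.snd = s • p.1.snd + t • q.1.snd := rfl

/-- The saddle-point error bound of a matrix game. -/
theorem exists_mul_infDist_le_duality_gap [Nonempty A] [Nonempty B] {M : Matrix A B ℝ} {v : ℝ}
    {x₀ : EuclideanSpace ℝ A} {y₀ : EuclideanSpace ℝ B} (h₀ : IsSaddle M v x₀ y₀) :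
    ∃ c : ℝ, 0 < c ∧ ∀ w : LocalPair A B, w.fst ∈ probSimplex A → w.snd ∈ probSimplex B →
      c * Metric.infDist w {w : LocalPair A B | IsSaddle M v w.fst w.snd} ≤
        maxPayoff M w.fst - minPayoff M w.snd := by
  classical
  obtain ⟨m, hm0, hm⟩ := exists_abs_le M
  -- `L` and `g` describe the epigraph of the duality gap over the product of simplices. The cap `2
  -- * m` makes it compact and loses nothing, since payoffs have absolute value at most `m`.
  set L : Set (LocalPair A B × ℝ) := {p | ∑ a, p.1.fst a = 1 ∧ ∑ b, p.1.snd b = 1} with hL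
  let g : A ⊕ B ⊕ (A × B) ⊕ Unit → LocalPair A B × ℝ → ℝ :=
    Sum.elim (fun a p => -p.1.fst a) <| Sum.elim (fun b p => -p.1.snd b) <|
      Sum.elim (fun ab p => payoff M p.1.fst (EuclideanSpace.single ab.2 1) -
        payoff M (EuclideanSpace.single ab.1 1) p.1.snd - p.2) fun _ p => p.2 - 2 * m
  have hgiff : ∀ p : LocalPair A B × ℝ, (p ∈ L ∧ ∀ i, g i p ≤ 0) ↔
      p.1.fst ∈ probSimplex A ∧ p.1.snd ∈ probSimplex B ∧
        (∀ x ∈ probSimplex A, ∀ y ∈ probSimplex B, payoff M p.1.fst y - payoff M x p.1.snd ≤ p.2) ∧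
        p.2 ≤ 2 * m := by
    intro p
    simp only [Sum.forall, g, Sum.elim_inl, Sum.elim_inr, Prod.forall, hL, Set.mem_ofPred_eq,
      probSimplex, forall_const, neg_nonpos, sub_nonpos]
    constructor
    · rintro ⟨⟨h1, h2⟩, h3, h4, h5, h6⟩
      exact ⟨⟨h3, h1⟩, ⟨h4, h2⟩, fun x hx y hy => payoff_le_of_forall_single h5 hx hy, h6⟩
    · rintro ⟨⟨h3, h1⟩, ⟨h4, h2⟩, h5, h6⟩
      exact ⟨⟨h1, h2⟩, h3, h4, fun a b => h5 _ (single_mem_probSimplex a) _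
        (single_mem_probSimplex b), h6⟩
  have hnn : ∀ p ∈ L, (∀ i, g i p ≤ 0) → 0 ≤ p.2 := by
    intro p hpL hp
    obtain ⟨h1, h2, h3, -⟩ := (hgiff p).1 ⟨hpL, hp⟩
    simpa using h3 _ h1 _ h2
  have hcomp : IsCompact {p | p ∈ L ∧ ∀ i, g i p ≤ 0} := by
    refine Metric.isCompact_of_isClosed_isBounded ?_ ?_
    · simp only [hgiff, Set.ofPred_and, Set.ofPred_forall]
      have c1 : Continuous fun p : LocalPair A B × ℝ => p.1.fst :=
        continuous_localPair_fst.comp continuous_fst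
      have c2 : Continuous fun p : LocalPair A B × ℝ => p.1.snd :=
        continuous_localPair_snd.comp continuous_fst
      refine ((probSimplex_isClosed A).preimage c1).inter
        (((probSimplex_isClosed B).preimage c2).inter (IsClosed.inter ?_ ?_))
      · exact isClosed_iInter fun x => isClosed_iInter fun _ => isClosed_iInter fun y =>
          isClosed_iInter fun _ => isClosed_le (((continuous_payoff_left M y).comp c1).sub
            ((continuous_payoff_right M x).comp c2)) continuous_snd
      · exact isClosed_le continuous_snd continuous_const
    · refine (Metric.isBounded_closedBall (x := (0 : LocalPair A B × ℝ))
        (r := max 2 (2 * m))).subset fun p hp => ?_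
      obtain ⟨h1, h2, -, h4⟩ := (hgiff p).1 hp
      have h5 := hnn p hp.1 hp.2
      rw [mem_closedBall_zero_iff, Prod.norm_def]
      exact max_le_max (norm_le_two_of_mem h1 h2) (by rwa [Real.norm_of_nonneg h5])
  have hLaff : ∀ p ∈ L, ∀ q ∈ L, ∀ t : ℝ, (1 - t) • p + t • q ∈ L := by
    rintro p ⟨hp1, hp2⟩ q ⟨hq1, hq2⟩ t
    refine ⟨?_, ?_⟩
    · simp only [fst_affine_combination, PiLp.add_apply, PiLp.smul_apply, smul_eq_mul,
        Finset.sum_add_distrib, ← Finset.mul_sum, hp1, hq1]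
      ring
    · simp only [snd_affine_combination, PiLp.add_apply, PiLp.smul_apply, smul_eq_mul,
        Finset.sum_add_distrib, ← Finset.mul_sum, hp2, hq2]
      ring
  have hgaff : ∀ i p q (t : ℝ), g i ((1 - t) • p + t • q) = (1 - t) * g i p + t * g i q := by
    rintro (a | b | ⟨a, b⟩ | u) p q t <;>
      simp only [g, Sum.elim_inl, Sum.elim_inr, fst_affine_combination, snd_affine_combination,
        PiLp.add_apply, PiLp.smul_apply, smul_eq_mul, payoff_add_left, payoff_add_right,
        payoff_smul_left, payoff_smul_right, Prod.snd_add, Prod.smul_snd] <;> ring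
  have hzero : ∀ p ∈ L, (∀ i, g i p ≤ 0) → p.2 = 0 →
      p.1 ∈ {w : LocalPair A B | IsSaddle M v w.fst w.snd} := by
    intro p hpL hp h0
    obtain ⟨h1, h2, h3, -⟩ := (hgiff p).1 ⟨hpL, hp⟩
    obtain ⟨hx₀, hy₀, hx₀v, hy₀v⟩ := h₀
    refine ⟨h1, h2, fun y' hy' => ?_, fun x' hx' => ?_⟩
    · linarith [h3 x₀ hx₀ y' hy', hx₀v _ h2]
    · linarith [h3 x' hx' y₀ hy₀, hy₀v _ h1]
  obtain ⟨c, hc, hcp⟩ := exists_mul_infDist_le_of_polytope L g hLaff hgaff hcomp hnn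
    (convex_setOf_isSaddle M v) ⟨WithLp.toLp 2 (x₀, y₀), h₀⟩ hzero
  refine ⟨c, hc, fun w h1 h2 => ?_⟩
  have h3 := (hgiff (w, maxPayoff M w.fst - minPayoff M w.snd)).2 ⟨h1, h2, fun x hx y hy =>
    sub_le_sub (payoff_le_maxPayoff M _ hy) (minPayoff_le_payoff M _ hx), ?_⟩
  · have h4 := hcp (w, maxPayoff M w.fst - minPayoff M w.snd) h3.1 h3.2
    exact h4
  · have := maxPayoff_le fun y hy => (abs_le.1 (abs_payoff_le_of_mem hm h1 hy)).2
    have := le_minPayoff fun x hx => (abs_le.1 (abs_payoff_le_of_mem hm hx h2)).1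
    change maxPayoff M w.fst - minPayoff M w.snd ≤ 2 * m
    linarith

end MarkovGame

namespace MarkovGame

variable {S A B : Type} [Fintype S] [Fintype A] [Fintype B]

/-! ### The Bellman equation and Shapley's theorem -/

/-- The effective horizon `1 / (1 - γ)`. -/
def horizon (G : MarkovGame S A B) : ℝ := 1 / (1 - G.disc)

theorem horizon_pos (G : MarkovGame S A B) : 0 < G.horizon :=
  one_div_pos.2 (sub_pos.2 G.disc_lt_one)

theorem one_add_disc_mul_horizon (G : MarkovGame S A B) : 1 + G.disc * G.horizon = G.horizon := by
  have : 1 - G.disc ≠ 0 := (sub_pos.2 G.disc_lt_one).ne'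
  unfold horizon
  field_simp
  ring

theorem one_le_horizon (G : MarkovGame S A B) : 1 ≤ G.horizon := by
  rw [← G.one_add_disc_mul_horizon]
  linarith [mul_nonneg G.disc_nonneg G.horizon_pos.le]

/-- The transition matrix of the Markov chain of the states under the policies `x`, `y`. -/
def stepMatrix (G : MarkovGame S A B) (x : S → EuclideanSpace ℝ A) (y : S → EuclideanSpace ℝ B) :
    Matrix S S ℝ :=
  Matrix.of fun s s' => ∑ a, ∑ b, x s a * y s b * G.trans s a b s'

theorem stepMatrix_nonneg (G : MarkovGame S A B) {x : S → EuclideanSpace ℝ A}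
    {y : S → EuclideanSpace ℝ B} (hx : x ∈ policies S A) (hy : y ∈ policies S B) (s s' : S) :
    0 ≤ G.stepMatrix x y s s' :=
  Finset.sum_nonneg fun a _ => Finset.sum_nonneg fun b _ =>
    mul_nonneg (mul_nonneg ((hx s).1 a) ((hy s).1 b)) (G.trans_nonneg _ _ _ _)

theorem sum_stepMatrix (G : MarkovGame S A B) {x : S → EuclideanSpace ℝ A}
    {y : S → EuclideanSpace ℝ B} (hx : x ∈ policies S A) (hy : y ∈ policies S B) (s : S) :
    ∑ s', G.stepMatrix x y s s' = 1 := by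
  simp only [stepMatrix, Matrix.of_apply]
  rw [Finset.sum_comm]
  simp_rw [Finset.sum_comm (s := (Finset.univ : Finset S)), ← Finset.mul_sum, G.trans_sum, mul_one,
    ← Finset.mul_sum, (hy s).2, mul_one, (hx s).2]

theorem stateLaw_eq_pow [DecidableEq S] (G : MarkovGame S A B) (x : S → EuclideanSpace ℝ A)
    (y : S → EuclideanSpace ℝ B) (s₀ : S) (t : ℕ) (s : S) :
    G.stateLaw x y s₀ t s = (G.stepMatrix x y ^ t) s₀ s := by
  induction t generalizing s with
  | zero => simp [stateLaw, Matrix.one_apply, eq_comm]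
  | succ t ih =>
    rw [pow_succ, Matrix.mul_apply]
    simp only [stateLaw, ih, stepMatrix, Matrix.of_apply, Finset.mul_sum, mul_assoc]

theorem value_eq_tsum [DecidableEq S] (G : MarkovGame S A B) (x : S → EuclideanSpace ℝ A)
    (y : S → EuclideanSpace ℝ B) (s₀ : S) :
    G.value x y s₀ = ∑' t : ℕ, G.disc ^ t *
      ((G.stepMatrix x y ^ t) *ᵥ fun s => payoff (G.reward s) (x s) (y s)) s₀ := by
  unfold value
  congr 1
  ext t
  congr 1
  simp only [Matrix.mulVec, dotProduct, stateLaw_eq_pow, payoff_eq_sum, Finset.mul_sum]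
  refine Finset.sum_congr rfl fun s _ => Finset.sum_congr rfl fun a _ =>
    Finset.sum_congr rfl fun b _ => ?_
  ring

theorem payoff_reward_mem (G : MarkovGame S A B) {x : S → EuclideanSpace ℝ A}
    {y : S → EuclideanSpace ℝ B} (hx : x ∈ policies S A) (hy : y ∈ policies S B) (s : S) :
    0 ≤ payoff (G.reward s) (x s) (y s) ∧ payoff (G.reward s) (x s) (y s) ≤ 1 := by
  constructor
  · conv_lhs => rw [← payoff_const 0 (hx s) (hy s)]
    exact payoff_mono (fun a b => G.reward_nonneg s a b) (hx s) (hy s)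
  · conv_rhs => rw [← payoff_const 1 (hx s) (hy s)]
    exact payoff_mono (fun a b => G.reward_le_one s a b) (hx s) (hy s)

theorem pow_mulVec_reward_mem [DecidableEq S] (G : MarkovGame S A B) {x : S → EuclideanSpace ℝ A}
    {y : S → EuclideanSpace ℝ B} (hx : x ∈ policies S A) (hy : y ∈ policies S B) (t : ℕ) (s : S) :
    0 ≤ ((G.stepMatrix x y ^ t) *ᵥ fun s => payoff (G.reward s) (x s) (y s)) s ∧
      ((G.stepMatrix x y ^ t) *ᵥ fun s => payoff (G.reward s) (x s) (y s)) s ≤ 1 := by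
  induction t generalizing s with
  | zero => simpa using G.payoff_reward_mem hx hy s
  | succ t ih =>
    rw [pow_succ', ← Matrix.mulVec_mulVec]
    constructor
    · exact Finset.sum_nonneg fun s' _ => mul_nonneg (G.stepMatrix_nonneg hx hy s s') (ih s').1
    · rw [← G.sum_stepMatrix hx hy s]
      exact Finset.sum_le_sum fun s' _ =>
        mul_le_of_le_one_right (G.stepMatrix_nonneg hx hy s s') (ih s').2

theorem payoff_bellmanQ (G : MarkovGame S A B) (x : S → EuclideanSpace ℝ A)
    (y : S → EuclideanSpace ℝ B) (v : S → ℝ) (s : S) :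
    payoff (G.bellmanQ v s) (x s) (y s) =
      payoff (G.reward s) (x s) (y s) + G.disc * ∑ s', G.stepMatrix x y s s' * v s' := by
  simp only [payoff_eq_sum, bellmanQ, stepMatrix, Matrix.of_apply, mul_add, add_mul,
    Finset.sum_add_distrib]
  congr 1
  simp only [Finset.sum_mul, Finset.mul_sum]
  rw [Finset.sum_comm (s := (Finset.univ : Finset S))]
  refine Finset.sum_congr rfl fun a _ => ?_
  rw [Finset.sum_comm (s := (Finset.univ : Finset S))]
  refine Finset.sum_congr rfl fun b _ => Finset.sum_congr rfl fun s' _ => ?_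
  ring

/-- The Bellman equation for a policy pair. -/
theorem value_eq_payoff (G : MarkovGame S A B) {x : S → EuclideanSpace ℝ A}
    {y : S → EuclideanSpace ℝ B} (hx : x ∈ policies S A) (hy : y ∈ policies S B) (s : S) :
    G.value x y s = payoff (G.qFun x y s) (x s) (y s) := by
  classical
  set u : ℕ → S → ℝ := fun t =>
    (G.stepMatrix x y ^ t) *ᵥ fun s => payoff (G.reward s) (x s) (y s) with hu
  have hsum : ∀ s, Summable fun t => G.disc ^ t * u t s := fun s => by
    refine Summable.of_nonneg_of_le
      (fun t => mul_nonneg (pow_nonneg G.disc_nonneg t) (G.pow_mulVec_reward_mem hx hy t s).1)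
      (fun t => mul_le_of_le_one_right (pow_nonneg G.disc_nonneg t)
        (G.pow_mulVec_reward_mem hx hy t s).2)
      (summable_geometric_of_lt_one G.disc_nonneg G.disc_lt_one)
  have hval : ∀ s, G.value x y s = ∑' t, G.disc ^ t * u t s := fun s => G.value_eq_tsum x y s
  rw [qFun, payoff_bellmanQ, hval, (hsum s).tsum_eq_zero_add]
  congr 1
  · simp [hu]
  · simp_rw [hval, ← tsum_mul_left]
    rw [← Summable.tsum_finsetSum fun s' _ => (hsum s').mul_left _, ← tsum_mul_left]
    congr 1
    ext t
    have : u (t + 1) s = ∑ s', G.stepMatrix x y s s' * u t s' := by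
      rw [hu]
      simp only [pow_succ']
      rw [← Matrix.mulVec_mulVec]
      rfl
    rw [this, Finset.mul_sum, Finset.mul_sum]
    refine Finset.sum_congr rfl fun s' _ => ?_
    ring

theorem bellmanQ_le_add (G : MarkovGame S A B) {v v' : S → ℝ} {δ : ℝ}
    (h : ∀ s, v s ≤ v' s + δ) (s : S) (a : A) (b : B) :
    G.bellmanQ v s a b ≤ G.bellmanQ v' s a b + G.disc * δ := by
  simp only [bellmanQ, Matrix.of_apply]
  have : ∑ s', G.trans s a b s' * v s' ≤ ∑ s', G.trans s a b s' * v' s' + δ := by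
    calc ∑ s', G.trans s a b s' * v s' ≤ ∑ s', G.trans s a b s' * (v' s' + δ) :=
          Finset.sum_le_sum fun s' _ => mul_le_mul_of_nonneg_left (h s') (G.trans_nonneg _ _ _ _)
      _ = _ := by
          simp_rw [mul_add, Finset.sum_add_distrib, ← Finset.sum_mul, G.trans_sum, one_mul]
  nlinarith [mul_le_mul_of_nonneg_left this G.disc_nonneg]

theorem abs_bellmanQ_sub_le (G : MarkovGame S A B) {v v' : S → ℝ} {δ : ℝ}
    (h : ∀ s, |v s - v' s| ≤ δ) (s : S) (a : A) (b : B) :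
    |(G.bellmanQ v s - G.bellmanQ v' s) a b| ≤ G.disc * δ := by
  rw [Matrix.sub_apply, abs_le]
  have h1 := G.bellmanQ_le_add (v := v) (v' := v') (δ := δ)
    (fun s => by linarith [(abs_le.1 (h s)).2]) s a b
  have h2 := G.bellmanQ_le_add (v := v') (v' := v) (δ := δ)
    (fun s => by linarith [(abs_le.1 (h s)).1]) s a b
  constructor <;> linarith

theorem payoff_bellmanQ_le_add (G : MarkovGame S A B) {v v' : S → ℝ} {δ : ℝ}
    (h : ∀ s, v s ≤ v' s + δ) (s : S) {x : EuclideanSpace ℝ A} {y : EuclideanSpace ℝ B}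
    (hx : x ∈ probSimplex A) (hy : y ∈ probSimplex B) :
    payoff (G.bellmanQ v s) x y ≤ payoff (G.bellmanQ v' s) x y + G.disc * δ := by
  have h1 : payoff (G.bellmanQ v s - G.bellmanQ v' s) x y ≤ G.disc * δ := by
    rw [← payoff_const (G.disc * δ) hx hy]
    refine payoff_mono (fun a b => ?_) hx hy
    have := G.bellmanQ_le_add h s a b
    simp only [Matrix.sub_apply, Matrix.of_apply]
    linarith
  rw [payoff_sub_matrix] at h1
  linarith

/-- At a state where `V - v` is largest, the Bellman equation gives `max (V - v) ≤ γ max (V - v) +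
ε`. All comparisons of values come from this and its mirror image: a bound on the one-step residual
of `v` under the policies is multiplied by the horizon. -/
theorem value_le_of_payoff_le (G : MarkovGame S A B) {x : S → EuclideanSpace ℝ A}
    {y : S → EuclideanSpace ℝ B} (hx : x ∈ policies S A) (hy : y ∈ policies S B) {v : S → ℝ}
    {ε : ℝ} (h : ∀ s, payoff (G.bellmanQ v s) (x s) (y s) ≤ v s + ε) (s : S) :
    G.value x y s ≤ v s + G.horizon * ε := by
  obtain ⟨s₁, -, hs₁⟩ := Finset.exists_max_image Finset.univ (fun s => G.value x y s - v s)
    ⟨s, Finset.mem_univ s⟩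
  have hmax : ∀ s, G.value x y s ≤ v s + (G.value x y s₁ - v s₁) := fun s => by
    linarith [hs₁ s (Finset.mem_univ s)]
  have h1 := G.payoff_bellmanQ_le_add hmax s₁ (hx s₁) (hy s₁)
  have h2 := G.value_eq_payoff hx hy s₁
  rw [qFun] at h2
  have h3 : (1 - G.disc) * (G.value x y s₁ - v s₁) ≤ ε := by linarith [h s₁]
  have h4 : G.value x y s₁ - v s₁ ≤ G.horizon * ε := by
    rw [horizon, div_mul_eq_mul_div, one_mul, le_div_iff₀ (sub_pos.2 G.disc_lt_one)]
    linarith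
  linarith [hmax s]

theorem le_value_of_le_payoff (G : MarkovGame S A B) {x : S → EuclideanSpace ℝ A}
    {y : S → EuclideanSpace ℝ B} (hx : x ∈ policies S A) (hy : y ∈ policies S B) {v : S → ℝ}
    {ε : ℝ} (h : ∀ s, v s ≤ payoff (G.bellmanQ v s) (x s) (y s) + ε) (s : S) :
    v s ≤ G.value x y s + G.horizon * ε := by
  obtain ⟨s₁, -, hs₁⟩ := Finset.exists_max_image Finset.univ (fun s => v s - G.value x y s)
    ⟨s, Finset.mem_univ s⟩
  have hmax : ∀ s, v s ≤ G.value x y s + (v s₁ - G.value x y s₁) := fun s => by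
    linarith [hs₁ s (Finset.mem_univ s)]
  have h1 := G.payoff_bellmanQ_le_add hmax s₁ (hx s₁) (hy s₁)
  have h2 := G.value_eq_payoff hx hy s₁
  rw [qFun] at h2
  have h3 : (1 - G.disc) * (v s₁ - G.value x y s₁) ≤ ε := by linarith [h s₁]
  have h4 : v s₁ - G.value x y s₁ ≤ G.horizon * ε := by
    rw [horizon, div_mul_eq_mul_div, one_mul, le_div_iff₀ (sub_pos.2 G.disc_lt_one)]
    linarith
  linarith [hmax s]

theorem abs_value_sub_le (G : MarkovGame S A B) {x : S → EuclideanSpace ℝ A}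
    {y : S → EuclideanSpace ℝ B} (hx : x ∈ policies S A) (hy : y ∈ policies S B) {v : S → ℝ}
    {ε : ℝ} (h : ∀ s, |payoff (G.bellmanQ v s) (x s) (y s) - v s| ≤ ε) (s : S) :
    |G.value x y s - v s| ≤ G.horizon * ε := by
  have h1 := G.value_le_of_payoff_le hx hy (v := v) (ε := ε)
    (fun s => by linarith [(abs_le.1 (h s)).2]) s
  have h2 := G.le_value_of_le_payoff hx hy (v := v) (ε := ε)
    (fun s => by linarith [(abs_le.1 (h s)).1]) s
  rw [abs_le]
  constructor <;> linarith

theorem value_nonneg (G : MarkovGame S A B) {x : S → EuclideanSpace ℝ A}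
    {y : S → EuclideanSpace ℝ B} (hx : x ∈ policies S A) (hy : y ∈ policies S B) (s : S) :
    0 ≤ G.value x y s := by
  have := G.le_value_of_le_payoff hx hy (v := fun _ => 0) (ε := 0) (fun s => by
    rw [payoff_bellmanQ]
    simpa using (G.payoff_reward_mem hx hy s).1) s
  simpa using this

theorem value_le_horizon (G : MarkovGame S A B) {x : S → EuclideanSpace ℝ A}
    {y : S → EuclideanSpace ℝ B} (hx : x ∈ policies S A) (hy : y ∈ policies S B) (s : S) :
    G.value x y s ≤ G.horizon := by
  have := G.value_le_of_payoff_le hx hy (v := fun _ => 0) (ε := 1) (fun s => by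
    rw [payoff_bellmanQ]
    simpa using (G.payoff_reward_mem hx hy s).2) s
  simpa using this

theorem bellmanQ_mem (G : MarkovGame S A B) {v : S → ℝ} (h0 : ∀ s, 0 ≤ v s)
    (hH : ∀ s, v s ≤ G.horizon) (s : S) (a : A) (b : B) :
    0 ≤ G.bellmanQ v s a b ∧ G.bellmanQ v s a b ≤ G.horizon := by
  have e : G.bellmanQ (fun _ => 0) s a b = G.reward s a b := by simp [bellmanQ]
  have h1 := G.bellmanQ_le_add (v := fun _ => 0) (v' := v) (δ := 0) (fun s => by simpa using h0 s)
    s a b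
  have h2 := G.bellmanQ_le_add (v := v) (v' := fun _ => 0) (δ := G.horizon)
    (fun s => by simpa using hH s) s a b
  have := G.one_add_disc_mul_horizon
  constructor
  · linarith [G.reward_nonneg s a b]
  · linarith [G.reward_le_one s a b]

/-- Both games are evaluated at the crossed pair `(x', y)`, where `M` pays at least `v` and `M'` at
most `v'`. Thus the value of a matrix game is 1-Lipschitz in the sup norm. -/
theorem IsSaddle.le_add_of_le_add {M M' : Matrix A B ℝ} {v v' δ : ℝ} {x x' : EuclideanSpace ℝ A}
    {y y' : EuclideanSpace ℝ B} (h : IsSaddle M v x y) (h' : IsSaddle M' v' x' y')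
    (hM : ∀ a b, M a b ≤ M' a b + δ) : v ≤ v' + δ := by
  have h1 : payoff (M - M') x' y ≤ δ := by
    rw [← payoff_const δ h'.1 h.2.1]
    refine payoff_mono (fun a b => ?_) h'.1 h.2.1
    simp only [Matrix.sub_apply, Matrix.of_apply]
    linarith [hM a b]
  rw [payoff_sub_matrix] at h1
  linarith [h.2.2.2 x' h'.1, h'.2.2.1 y h.2.1]

/-- Shapley's operator has a fixed point. -/
theorem exists_shapley_fixedPoint [Nonempty A] [Nonempty B] (G : MarkovGame S A B) :
    ∃ w : S → ℝ, ∀ s, ∃ x y, IsSaddle (G.bellmanQ w s) (w s) x y := by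
  choose val hval using fun M : Matrix A B ℝ => exists_isSaddle M
  let T : (S → ℝ) → S → ℝ := fun v s => val (G.bellmanQ v s)
  -- The value is 1-Lipschitz in the matrix and `bellmanQ` scales differences by the discount
  -- factor, so the operator is a contraction in the sup norm.
  have hT : ContractingWith ⟨G.disc, G.disc_nonneg⟩ T := by
    refine ⟨by exact_mod_cast G.disc_lt_one, LipschitzWith.of_dist_le_mul fun v v' => ?_⟩
    change dist (T v) (T v') ≤ G.disc * dist v v'
    rw [dist_pi_le_iff (mul_nonneg G.disc_nonneg dist_nonneg)]
    intro s
    have hd : ∀ s, |v s - v' s| ≤ dist v v' := fun s => dist_le_pi_dist v v' s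
    obtain ⟨x, y, h⟩ := hval (G.bellmanQ v s)
    obtain ⟨x', y', h'⟩ := hval (G.bellmanQ v' s)
    have h1 := h.le_add_of_le_add h'
      (G.bellmanQ_le_add (fun s => by linarith [(abs_le.1 (hd s)).2]) s)
    have h2 := h'.le_add_of_le_add h
      (G.bellmanQ_le_add (fun s => by linarith [(abs_le.1 (hd s)).1]) s)
    rw [Real.dist_eq, abs_le]
    constructor <;> linarith
  refine ⟨hT.fixedPoint T, fun s => ?_⟩
  obtain ⟨x, y, h⟩ := hval (G.bellmanQ (hT.fixedPoint T) s)
  refine ⟨x, y, ?_⟩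
  have e : val (G.bellmanQ (hT.fixedPoint T) s) = hT.fixedPoint T s :=
    congrFun hT.fixedPoint_isFixedPt s
  rwa [e] at h

/-- The minimax value is the fixed point of Shapley's operator. -/
theorem gameValue_eq_of_fixedPoint (G : MarkovGame S A B) {w : S → ℝ}
    {X : S → EuclideanSpace ℝ A} {Y : S → EuclideanSpace ℝ B}
    (h : ∀ s, IsSaddle (G.bellmanQ w s) (w s) (X s) (Y s)) (s : S) : G.gameValue s = w s := by
  have hX : X ∈ policies S A := fun s => (h s).1
  have hY : Y ∈ policies S B := fun s => (h s).2.1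
  have : Nonempty (policies S A) := ⟨⟨X, hX⟩⟩
  have : Nonempty (policies S B) := ⟨⟨Y, hY⟩⟩
  have hbdd : ∀ x : policies S A, BddAbove (Set.range fun y : policies S B => G.value x.1 y.1 s) :=
    fun x => ⟨G.horizon, by rintro _ ⟨y, rfl⟩; exact G.value_le_horizon x.2 y.2 s⟩
  -- The stationary policy `Y` secures at least `w` against every `x`; below, `X` concedes at most
  -- `w` against every `y`.
  have hge : ∀ x : policies S A, w s ≤ ⨆ y : policies S B, G.value x.1 y.1 s := fun x => by
    refine le_trans ?_ (le_ciSup (hbdd x) ⟨Y, hY⟩)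
    simpa using G.le_value_of_le_payoff x.2 hY (v := w) (ε := 0)
      (fun s => by simpa using (h s).2.2.2 _ (x.2 s)) s
  refine le_antisymm ((ciInf_le ⟨w s, ?_⟩ ⟨X, hX⟩).trans (ciSup_le fun y => ?_)) (le_ciInf hge)
  · rintro _ ⟨x, rfl⟩
    exact hge x
  · simpa using G.value_le_of_payoff_le hX y.2 (v := w) (ε := 0)
      (fun s => by simpa using (h s).2.2.1 _ (y.2 s)) s

theorem exists_isSaddle_qStar [Nonempty A] [Nonempty B] (G : MarkovGame S A B) :
    ∃ (X : S → EuclideanSpace ℝ A) (Y : S → EuclideanSpace ℝ B),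
      ∀ s, IsSaddle (G.qStar s) (G.gameValue s) (X s) (Y s) := by
  obtain ⟨w, hw⟩ := G.exists_shapley_fixedPoint
  choose X Y h using hw
  have e : G.gameValue = w := funext fun s => G.gameValue_eq_of_fixedPoint h s
  exact ⟨X, Y, fun s => by rw [qStar, e]; exact h s⟩

theorem gameValue_mem [Nonempty A] [Nonempty B] (G : MarkovGame S A B) (s : S) :
    0 ≤ G.gameValue s ∧ G.gameValue s ≤ G.horizon := by
  obtain ⟨X, Y, h⟩ := G.exists_isSaddle_qStar
  have hX : X ∈ policies S A := fun s => (h s).1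
  have hY : Y ∈ policies S B := fun s => (h s).2.1
  have h1 := G.le_value_of_le_payoff hX hY (v := G.gameValue) (ε := 0)
      (fun s => by simpa [qStar] using (h s).2.2.2 _ (hX s)) s
  have h2 := G.value_le_of_payoff_le hX hY (v := G.gameValue) (ε := 0)
      (fun s => by simpa [qStar] using (h s).2.2.1 _ (hY s)) s
  rw [mul_zero, add_zero] at h1 h2
  exact ⟨(G.value_nonneg hX hY s).trans h2, h1.trans (G.value_le_horizon hX hY s)⟩

theorem zStarAt_eq [Nonempty A] [Nonempty B] (G : MarkovGame S A B) (s : S) :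
    G.zStarAt s = {w : LocalPair A B | IsSaddle (G.qStar s) (G.gameValue s) w.fst w.snd} := by
  obtain ⟨X, Y, h⟩ := G.exists_isSaddle_qStar
  ext w
  exact (isSaddle_iff_of_isSaddle (h s) w.fst w.snd).symm

theorem zStarAt_nonempty [Nonempty A] [Nonempty B] (G : MarkovGame S A B) (s : S) :
    (G.zStarAt s).Nonempty := by
  obtain ⟨X, Y, h⟩ := G.exists_isSaddle_qStar
  rw [zStarAt_eq]
  exact ⟨WithLp.toLp 2 (X s, Y s), h s⟩

theorem isClosed_zStarAt [Nonempty A] [Nonempty B] (G : MarkovGame S A B) (s : S) :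
    IsClosed (G.zStarAt s) := by
  rw [zStarAt_eq]
  exact isClosed_setOf_isSaddle _ _

theorem qStar_mem [Nonempty A] [Nonempty B] (G : MarkovGame S A B) (s : S) (a : A) (b : B) :
    0 ≤ G.qStar s a b ∧ G.qStar s a b ≤ G.horizon :=
  G.bellmanQ_mem (fun s => (G.gameValue_mem s).1) (fun s => (G.gameValue_mem s).2) s a b

theorem qFun_mem (G : MarkovGame S A B) {x : S → EuclideanSpace ℝ A}
    {y : S → EuclideanSpace ℝ B} (hx : x ∈ policies S A) (hy : y ∈ policies S B)
    (s : S) (a : A) (b : B) : 0 ≤ G.qFun x y s a b ∧ G.qFun x y s a b ≤ G.horizon :=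
  G.bellmanQ_mem (G.value_nonneg hx hy) (G.value_le_horizon hx hy) s a b

theorem exists_isErrorBoundConst [Nonempty A] [Nonempty B] (G : MarkovGame S A B) :
    ∃ c, G.IsErrorBoundConst c := by
  obtain ⟨X, Y, h⟩ := G.exists_isSaddle_qStar
  choose c hc hcw using fun s => exists_mul_infDist_le_duality_gap (h s)
  have hmin : ∃ m : ℝ, 0 < m ∧ ∀ s, m ≤ c s := by
    rcases isEmpty_or_nonempty S with hS | hS
    · exact ⟨1, one_pos, fun s => hS.elim s⟩
    · obtain ⟨s₀, hs₀⟩ := Finite.exists_min c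
      exact ⟨c s₀, hc s₀, hs₀⟩
  obtain ⟨m, hm, hmc⟩ := hmin
  refine ⟨m, hm, fun z hz s => ?_⟩
  refine (mul_le_mul_of_nonneg_right (hmc s) Metric.infDist_nonneg).trans ?_
  rw [zStarAt_eq]
  exact hcw s _ (hz s).1 (hz s).2

end MarkovGame

namespace MarkovGame

variable {S A B : Type} [Fintype S] [Fintype A] [Fintype B]

/-! ### The gradient field -/

/-- The number `A + B` of actions. -/
def actionCount (A B : Type) [Fintype A] [Fintype B] : ℝ := Fintype.card A + Fintype.card B

theorem one_le_actionCount [Nonempty A] : 1 ≤ actionCount A B := by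
  have : (1 : ℝ) ≤ Fintype.card A := by exact_mod_cast Fintype.card_pos
  unfold actionCount
  linarith [(Nat.cast_nonneg (Fintype.card B) : (0 : ℝ) ≤ _)]

theorem l1Norm_le [Nonempty A] (w : LocalPair A B) : l1Norm w ≤ actionCount A B * ‖w‖ := by
  have h := l1Norm_sq_le w
  have h1 := one_le_actionCount (A := A) (B := B)
  change _ ≤ actionCount A B * _ at h
  have : l1Norm w ^ 2 ≤ (actionCount A B * ‖w‖) ^ 2 := by
    rw [mul_pow]
    nlinarith [sq_nonneg ‖w‖, mul_nonneg (sub_nonneg.2 h1) (sq_nonneg ‖w‖)]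
  exact le_of_sq_le_sq this (by positivity)

theorem norm_apply_le (z : JointPair S A B) (s : S) : ‖z s‖ ≤ ‖z‖ := PiLp.norm_apply_le z s

theorem norm_sq_le_of_forall_abs_le {w : LocalPair A B} {m : ℝ} (h1 : ∀ a, |w.fst a| ≤ m)
    (h2 : ∀ b, |w.snd b| ≤ m) : ‖w‖ ^ 2 ≤ actionCount A B * m ^ 2 := by
  have key : ∀ {ι : Type} [Fintype ι] (x : EuclideanSpace ℝ ι), (∀ i, |x i| ≤ m) →
      ‖x‖ ^ 2 ≤ Fintype.card ι * m ^ 2 := by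
    intro ι _ x hx
    rw [EuclideanSpace.norm_sq_eq]
    refine (Finset.sum_le_card_nsmul _ _ (m ^ 2) fun i _ => ?_).trans (by simp)
    exact pow_le_pow_left₀ (norm_nonneg _) (hx i) 2
  rw [WithLp.prod_norm_sq_eq_of_L2, actionCount, add_mul]
  exact add_le_add (key _ h1) (key _ h2)

/-- The gradient field `(M y, -Mᵀ x)` of the matrix game `M`. -/
def localField (M : Matrix A B ℝ) (w : LocalPair A B) : LocalPair A B :=
  WithLp.toLp 2 (WithLp.toLp 2 (M *ᵥ w.snd.ofLp), -WithLp.toLp 2 (Mᵀ *ᵥ w.fst.ofLp))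

/-- The Q-function of a policy pair. -/
def pairQ (G : MarkovGame S A B) (z : JointPair S A B) (s : S) : Matrix A B ℝ :=
  G.qFun (fun s => (z s).fst) (fun s => (z s).snd) s

/-- The value function of a policy pair. -/
def pairValue (G : MarkovGame S A B) (z : JointPair S A B) (s : S) : ℝ :=
  G.value (fun s => (z s).fst) (fun s => (z s).snd) s

/-- The gradient field of the game. -/
def field (G : MarkovGame S A B) (z : JointPair S A B) : JointPair S A B :=
  WithLp.toLp 2 fun s => localField (G.pairQ z s) (z s)

theorem inner_localField (M : Matrix A B ℝ) (w u : LocalPair A B) :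
    inner ℝ (localField M w) u = payoff M u.fst w.snd - payoff M w.fst u.snd := by
  have h1 : inner ℝ (localField M w).fst u.fst = payoff M u.fst w.snd := by
    simp [localField, payoff, EuclideanSpace.inner_eq_star_dotProduct]
  have h2 : inner ℝ (localField M w).snd u.snd = -payoff M w.fst u.snd := by
    change inner ℝ (-WithLp.toLp 2 (Mᵀ *ᵥ w.fst.ofLp)) u.snd = _
    rw [inner_neg_left, EuclideanSpace.inner_eq_star_dotProduct, payoff, Matrix.dotProduct_mulVec,
      Matrix.mulVec_transpose, dotProduct_comm]
    simp
  rw [WithLp.prod_inner_apply, sub_eq_add_neg, ← h1, ← h2]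
  rfl

theorem abs_payoff_sub_le {M : Matrix A B ℝ} {h : ℝ} (hM : ∀ a b, |M a b| ≤ h)
    {x x' : EuclideanSpace ℝ A} {y y' : EuclideanSpace ℝ B} (hx' : x' ∈ probSimplex A)
    (hy : y ∈ probSimplex B) :
    |payoff M x y - payoff M x' y'| ≤ h * (∑ a, |(x - x') a| + ∑ b, |(y - y') b|) := by
  have e : payoff M x y - payoff M x' y' = payoff M (x - x') y + payoff M x' (y - y') := by
    rw [payoff_sub_left, payoff_sub_right]
    ring
  have h1 := abs_payoff_le hM (x - x') y
  have h2 := abs_payoff_le hM x' (y - y')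
  rw [sum_abs_of_mem_probSimplex hy, mul_one] at h1
  rw [sum_abs_of_mem_probSimplex hx', mul_one] at h2
  rw [e]
  linarith [abs_add_le (payoff M (x - x') y) (payoff M x' (y - y'))]

theorem abs_mulVec_sub_le {M M' : Matrix A B ℝ} {δ h : ℝ} (hd : ∀ a b, |(M - M') a b| ≤ δ)
    (hM' : ∀ a b, |M' a b| ≤ h) {y y' : EuclideanSpace ℝ B} (hy : y ∈ probSimplex B) (a : A) :
    |(M *ᵥ y.ofLp) a - (M' *ᵥ y'.ofLp) a| ≤ δ + h * ∑ b, |(y - y') b| := by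
  have key : ∀ (M : Matrix A B ℝ) (y : EuclideanSpace ℝ B) (m : ℝ), (∀ a b, |M a b| ≤ m) →
      |(M *ᵥ y.ofLp) a| ≤ m * ∑ b, |y b| := by
    intro M y m hm
    rw [Finset.mul_sum]
    refine (Finset.abs_sum_le_sum_abs _ _).trans (Finset.sum_le_sum fun b _ => ?_)
    rw [abs_mul]
    exact mul_le_mul_of_nonneg_right (hm a b) (abs_nonneg _)
  have e : (M *ᵥ y.ofLp) a - (M' *ᵥ y'.ofLp) a =
      ((M - M') *ᵥ y.ofLp) a + (M' *ᵥ (y - y').ofLp) a := by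
    simp [Matrix.sub_mulVec, Matrix.mulVec_sub]
  have h1 := key _ y δ hd
  have h2 := key _ (y - y') h hM'
  rw [sum_abs_of_mem_probSimplex hy, mul_one] at h1
  rw [e]
  exact (abs_add_le _ _).trans (add_le_add h1 h2)

/-- Each coordinate of the difference splits into `M - M'` applied to a probability vector, which
costs `δ`, and `M'` applied to a difference of strategies. -/
theorem norm_sq_localField_sub_le {M M' : Matrix A B ℝ} {δ h : ℝ}
    (hd : ∀ a b, |(M - M') a b| ≤ δ) (hM' : ∀ a b, |M' a b| ≤ h) (h0 : 0 ≤ h)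
    {w w' : LocalPair A B} (hw1 : w.fst ∈ probSimplex A) (hw2 : w.snd ∈ probSimplex B) :
    ‖localField M w - localField M' w'‖ ^ 2 ≤
      actionCount A B * (δ + h * l1Norm (w - w')) ^ 2 := by
  have p1 : 0 ≤ ∑ a, |(w.fst - w'.fst) a| := by positivity
  have p2 : 0 ≤ ∑ b, |(w.snd - w'.snd) b| := by positivity
  have e : l1Norm (w - w') = ∑ a, |(w.fst - w'.fst) a| + ∑ b, |(w.snd - w'.snd) b| := rfl
  refine norm_sq_le_of_forall_abs_le (fun a => ?_) fun b => ?_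
  · have := abs_mulVec_sub_le hd hM' (y' := w'.snd) hw2 a
    change |(M *ᵥ w.snd.ofLp) a - (M' *ᵥ w'.snd.ofLp) a| ≤ _
    rw [e]
    nlinarith [mul_nonneg h0 p1]
  · have := abs_mulVec_sub_le (M := Mᵀ) (M' := M'ᵀ) (fun b a => hd a b) (fun b a => hM' a b)
      (y' := w'.fst) hw1 b
    change |-(Mᵀ *ᵥ w.fst.ofLp) b - -(M'ᵀ *ᵥ w'.fst.ofLp) b| ≤ _
    rw [← neg_sub', abs_neg, e]
    nlinarith [mul_nonneg h0 p2]

theorem fst_mem_policies {z : JointPair S A B} (hz : z ∈ policyPairs S A B) :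
    (fun s => (z s).fst) ∈ policies S A := fun s => (hz s).1

theorem snd_mem_policies {z : JointPair S A B} (hz : z ∈ policyPairs S A B) :
    (fun s => (z s).snd) ∈ policies S B := fun s => (hz s).2

theorem abs_pairQ_le (G : MarkovGame S A B) {z : JointPair S A B} (hz : z ∈ policyPairs S A B)
    (s : S) (a : A) (b : B) : |G.pairQ z s a b| ≤ G.horizon := by
  have := G.qFun_mem (fst_mem_policies hz) (snd_mem_policies hz) s a b
  rw [pairQ, abs_of_nonneg this.1]
  exact this.2

theorem abs_qStar_le [Nonempty A] [Nonempty B] (G : MarkovGame S A B) (s : S) (a : A) (b : B) :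
    |G.qStar s a b| ≤ G.horizon := by
  have := G.qStar_mem s a b
  rw [abs_of_nonneg this.1]
  exact this.2

/-- The gradient field of the game is Lipschitz. -/
theorem norm_field_sub_le (G : MarkovGame S A B) {u v : JointPair S A B}
    (hu : u ∈ policyPairs S A B) (hv : v ∈ policyPairs S A B) :
    ‖G.field u - G.field v‖ ≤
      2 * √(Fintype.card S) * actionCount A B * G.horizon ^ 2 * ‖u - v‖ := by
  set N := actionCount A B with hN
  have hN0 : 0 ≤ N := by rw [hN, actionCount]; positivity
  have hH := G.one_le_horizon
  set D := √N * ‖u - v‖ with hD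
  have hD0 : 0 ≤ D := by positivity
  have hDs : ∀ s, l1Norm (u s - v s) ≤ D := fun s => by
    have h1 := l1Norm_sq_le (u s - v s)
    have h2 := norm_apply_le (u - v) s
    refine le_of_sq_le_sq (h1.trans ?_) hD0
    rw [hD, mul_pow, Real.sq_sqrt hN0]
    exact mul_le_mul_of_nonneg_left (pow_le_pow_left₀ (norm_nonneg _) h2 2) hN0
  -- The value of `v` is tested in the Bellman equation of `u`. Its residual is the change of the
  -- bilinear payoff of the fixed matrix `pairQ v s` from `v` to `u`.
  have hV : ∀ s, |G.pairValue u s - G.pairValue v s| ≤ G.horizon * (G.horizon * D) := by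
    refine G.abs_value_sub_le (fst_mem_policies hu) (snd_mem_policies hu) fun s => ?_
    have e := G.value_eq_payoff (fst_mem_policies hv) (snd_mem_policies hv) s
    change |payoff (G.pairQ v s) (u s).fst (u s).snd - G.value _ _ s| ≤ _
    rw [e]
    exact (abs_payoff_sub_le (G.abs_pairQ_le hv s) (hv s).1 (hu s).2).trans
      (mul_le_mul_of_nonneg_left (hDs s) G.horizon_pos.le)
  have hQ : ∀ s a b, |(G.pairQ u s - G.pairQ v s) a b| ≤ G.horizon ^ 2 * D := fun s a b => by
    refine (G.abs_bellmanQ_sub_le hV s a b).trans ?_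
    have : 0 ≤ G.horizon * (G.horizon * D) := by positivity
    nlinarith [mul_le_mul_of_nonneg_right G.disc_lt_one.le this]
  have hloc : ∀ s, ‖(G.field u - G.field v) s‖ ^ 2 ≤ N * (2 * G.horizon ^ 2 * D) ^ 2 := fun s => by
    refine (norm_sq_localField_sub_le (hQ s) (G.abs_pairQ_le hv s) G.horizon_pos.le (hu s).1
      (hu s).2).trans (mul_le_mul_of_nonneg_left (pow_le_pow_left₀ ?_ ?_ 2) hN0)
    · have := l1Norm_nonneg (u s - v s)
      positivity
    · have h1 := mul_le_mul_of_nonneg_left (hDs s) G.horizon_pos.le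
      have h2 : G.horizon * D ≤ G.horizon ^ 2 * D := by
        rw [sq, mul_assoc]
        exact le_mul_of_one_le_left (by positivity) hH
      linarith
  refine le_of_sq_le_sq ?_ (by positivity)
  rw [PiLp.norm_sq_eq_of_L2]
  refine (Finset.sum_le_card_nsmul _ _ _ fun s _ => hloc s).trans (le_of_eq ?_)
  have h1 : √(Fintype.card S : ℝ) ^ 2 = Fintype.card S := Real.sq_sqrt (Nat.cast_nonneg _)
  have h2 : √N ^ 2 = N := Real.sq_sqrt hN0
  rw [nsmul_eq_mul, Finset.card_univ, hD]
  simp only [mul_pow, h1, h2]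
  ring

/-! ### Estimates around an equilibrium -/

theorem isSaddle_of_mem_zStar [Nonempty A] [Nonempty B] (G : MarkovGame S A B)
    {z : JointPair S A B} (hz : z ∈ G.zStar) (s : S) :
    IsSaddle (G.qStar s) (G.gameValue s) (z s).fst (z s).snd := by
  have := hz s
  rwa [zStarAt_eq] at this

theorem zStar_subset_policyPairs (G : MarkovGame S A B) : G.zStar ⊆ policyPairs S A B :=
  fun _ hz s => ⟨(hz s).1.1, (hz s).2.1⟩

theorem zStar_nonempty [Nonempty A] [Nonempty B] (G : MarkovGame S A B) : G.zStar.Nonempty := by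
  choose z hz using G.zStarAt_nonempty
  exact ⟨WithLp.toLp 2 z, hz⟩

theorem isClosed_zStar [Nonempty A] [Nonempty B] (G : MarkovGame S A B) : IsClosed G.zStar := by
  have : G.zStar = ⋂ s, {z : JointPair S A B | z s ∈ G.zStarAt s} := by
    ext z
    simp [zStar]
  rw [this]
  exact isClosed_iInter fun s => (G.isClosed_zStarAt s).preimage (PiLp.continuous_apply 2 _ s)

/-- Since the equilibrium set is a product over the states, nearest points chosen state by state
form an equilibrium. -/
theorem infDist_zStar_sq_le [Nonempty A] [Nonempty B] (G : MarkovGame S A B)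
    (z : JointPair S A B) :
    Metric.infDist z G.zStar ^ 2 ≤ ∑ s, Metric.infDist (z s) (G.zStarAt s) ^ 2 := by
  choose p hp hpd using fun s =>
    (G.isClosed_zStarAt s).exists_infDist_eq_dist (G.zStarAt_nonempty s) (z s)
  have h1 : Metric.infDist z G.zStar ≤ dist z (WithLp.toLp 2 p) :=
    Metric.infDist_le_dist_of_mem fun s => hp s
  refine (pow_le_pow_left₀ Metric.infDist_nonneg h1 2).trans (le_of_eq ?_)
  rw [dist_eq_norm, PiLp.norm_sq_eq_of_L2]
  refine Finset.sum_congr rfl fun s _ => ?_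
  rw [hpd s, dist_eq_norm]
  rfl

/-- The gap `xᵀ Q* y* - x*ᵀ Q* y` of the pair `v = (x, y)` relative to `z = (x*, y*)`, summed over
all states. -/
def relGap (G : MarkovGame S A B) (v z : JointPair S A B) : ℝ :=
  ∑ s, (payoff (G.qStar s) (v s).fst (z s).snd - payoff (G.qStar s) (z s).fst (v s).snd)

section Equilibrium

variable [Nonempty A] [Nonempty B] (G : MarkovGame S A B) {v z : JointPair S A B}

theorem localGap_nonneg (hv : v ∈ policyPairs S A B) (hz : z ∈ G.zStar) (s : S) :
    0 ≤ payoff (G.qStar s) (v s).fst (z s).snd - payoff (G.qStar s) (z s).fst (v s).snd := by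
  have h := G.isSaddle_of_mem_zStar hz s
  linarith [h.2.2.1 _ (hv s).2, h.2.2.2 _ (hv s).1]

theorem relGap_nonneg (hv : v ∈ policyPairs S A B) (hz : z ∈ G.zStar) : 0 ≤ G.relGap v z :=
  Finset.sum_nonneg fun s _ => G.localGap_nonneg hv hz s

theorem relGap_le (hv : v ∈ policyPairs S A B) (hz : z ∈ G.zStar) :
    G.relGap v z ≤ Fintype.card S * G.horizon := by
  have hz' := G.zStar_subset_policyPairs hz
  refine (Finset.sum_le_card_nsmul _ _ G.horizon fun s _ => ?_).trans (by simp)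
  have h1 := payoff_mono (fun a b => (G.qStar_mem s a b).2) (M' := Matrix.of fun _ _ => G.horizon)
    (hv s).1 (hz' s).2
  have h2 := payoff_mono (fun a b => (G.qStar_mem s a b).1) (M := Matrix.of fun _ _ => 0)
    (hz' s).1 (hv s).2
  rw [payoff_const _ (hv s).1 (hz' s).2] at h1
  rw [payoff_const _ (hz' s).1 (hv s).2] at h2
  linarith

/-- The residual of `v*` in the Bellman equation of `v = (x, y)` is `xᵀQ*y - v*`. Expanding around
`(x*, y*)`, it equals `(xᵀQ*y* - v*) + (x*ᵀQ*y - v*) + (x - x*)ᵀQ*(y - y*)`. The first two terms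
have opposite signs and size at most the gap, and the third is quadratic in the distance. A plain
Lipschitz estimate would leave a linear term, which could not be absorbed. -/
theorem abs_pairValue_sub_gameValue_le (hv : v ∈ policyPairs S A B) (hz : z ∈ G.zStar) {D : ℝ}
    (hD : ∀ s, l1Norm (v s - z s) ≤ D) (s : S) :
    |G.pairValue v s - G.gameValue s| ≤ G.horizon * (G.relGap v z + G.horizon * D ^ 2) := by
  have hz' := G.zStar_subset_policyPairs hz
  refine G.abs_value_sub_le (fst_mem_policies hv) (snd_mem_policies hv) (fun s => ?_) s
  change |payoff (G.qStar s) (v s).fst (v s).snd - G.gameValue s| ≤ _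
  have h := G.isSaddle_of_mem_zStar hz s
  have h1 := h.2.2.1 _ (hv s).2
  have h2 := h.2.2.2 _ (hv s).1
  have h3 := h.2.2.1 _ (hz' s).2
  have h4 := h.2.2.2 _ (hz' s).1
  have hg : payoff (G.qStar s) (v s).fst (z s).snd - payoff (G.qStar s) (z s).fst (v s).snd ≤
      G.relGap v z :=
    Finset.single_le_sum (f := fun s => payoff (G.qStar s) (v s).fst (z s).snd -
      payoff (G.qStar s) (z s).fst (v s).snd) (fun s _ => G.localGap_nonneg hv hz s)
      (Finset.mem_univ s)
  have hb := abs_payoff_le (G.abs_qStar_le s) ((v s).fst - (z s).fst) ((v s).snd - (z s).snd)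
  have p1 : 0 ≤ ∑ a, |((v s).fst - (z s).fst) a| := by positivity
  have p2 : 0 ≤ ∑ b, |((v s).snd - (z s).snd) b| := by positivity
  have hDs : ∑ a, |((v s).fst - (z s).fst) a| + ∑ b, |((v s).snd - (z s).snd) b| ≤ D := hD s
  have hb2 : |payoff (G.qStar s) ((v s).fst - (z s).fst) ((v s).snd - (z s).snd)| ≤
      G.horizon * D ^ 2 := by
    refine hb.trans ?_
    rw [mul_assoc]
    refine mul_le_mul_of_nonneg_left ?_ G.horizon_pos.le
    nlinarith
  rw [payoff_sub_left, payoff_sub_right, payoff_sub_right, abs_le] at hb2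
  rw [abs_le]
  constructor <;> linarith

/-- Near an equilibrium, `Q^{x,y}` differs from `Q*` by the gap and a quadratic term. -/
theorem abs_pairQ_sub_qStar_le (hv : v ∈ policyPairs S A B) (hz : z ∈ G.zStar) {D : ℝ}
    (hD : ∀ s, l1Norm (v s - z s) ≤ D) (s : S) (a : A) (b : B) :
    |(G.pairQ v s - G.qStar s) a b| ≤ G.horizon * (G.relGap v z + G.horizon * D ^ 2) := by
  have h1 := G.abs_bellmanQ_sub_le (G.abs_pairValue_sub_gameValue_le hv hz hD) s a b
  have h2 := G.relGap_nonneg hv hz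
  have h3 := G.horizon_pos.le
  have : 0 ≤ G.horizon * (G.relGap v z + G.horizon * D ^ 2) := by positivity
  exact h1.trans (mul_le_of_le_one_left this G.disc_lt_one.le)

theorem pairQ_eq_qStar (hz : z ∈ G.zStar) (s : S) : G.pairQ z s = G.qStar s := by
  have hz' := G.zStar_subset_policyPairs hz
  have h0 : G.relGap z z = 0 := Finset.sum_eq_zero fun s _ => sub_self _
  ext a b
  have := G.abs_pairQ_sub_qStar_le hz' hz (D := 0) (fun s => by simp [l1Norm]) s a b
  rw [h0, Matrix.sub_apply] at this
  have h1 : |G.pairQ z s a b - G.qStar s a b| ≤ 0 := by simpa using this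
  linarith [abs_nonpos_iff.1 h1]

/-- Equilibria solve the variational inequality of the field, so a projected step taken at an
equilibrium stays there. -/
theorem inner_field_equilibrium_nonneg (hz : z ∈ G.zStar) (hv : v ∈ policyPairs S A B) :
    0 ≤ inner ℝ (G.field z) (v - z) := by
  rw [PiLp.inner_apply]
  refine Finset.sum_nonneg fun s _ => ?_
  change 0 ≤ inner ℝ (localField (G.pairQ z s) (z s)) (v s - z s)
  rw [inner_localField, pairQ_eq_qStar G hz]
  have h := G.localGap_nonneg hv hz s
  change 0 ≤ payoff _ ((v s).fst - (z s).fst) _ - payoff _ _ ((v s).snd - (z s).snd)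
  rw [payoff_sub_left, payoff_sub_right]
  linarith

/-- This replaces monotonicity of the field. With `qStar` instead of `pairQ` the inner product would
be exactly `relGap`; in each state the exchange costs at most the entrywise error of the matrix
times the `ℓ¹` distance `D`. -/
theorem relGap_sub_le_inner_field (hv : v ∈ policyPairs S A B) (hz : z ∈ G.zStar) {D : ℝ}
    (hD : ∀ s, l1Norm (v s - z s) ≤ D) :
    G.relGap v z - Fintype.card S * (G.horizon * (G.relGap v z + G.horizon * D ^ 2) * D) ≤
      inner ℝ (G.field v) (v - z) := by
  have hz' := G.zStar_subset_policyPairs hz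
  set e := G.horizon * (G.relGap v z + G.horizon * D ^ 2) with he
  have he0 : 0 ≤ e := by
    have h2 := G.relGap_nonneg hv hz
    have h3 := G.horizon_pos.le
    positivity
  have hsum : (Fintype.card S : ℝ) * (e * D) = ∑ _s : S, e * D := by simp
  rw [PiLp.inner_apply, hsum, relGap, ← Finset.sum_sub_distrib]
  refine Finset.sum_le_sum fun s _ => ?_
  change _ ≤ inner ℝ (localField (G.pairQ v s) (v s)) (v s - z s)
  rw [inner_localField]
  change _ ≤ payoff _ ((v s).fst - (z s).fst) _ - payoff _ _ ((v s).snd - (z s).snd)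
  rw [payoff_sub_left, payoff_sub_right]
  have h1 := abs_payoff_sub_le (G.abs_pairQ_sub_qStar_le hv hz hD s) (x := (v s).fst)
    (y' := (v s).snd) (hz' s).1 (hz' s).2
  have hDs : ∑ a, |((v s).fst - (z s).fst) a| + ∑ b, |((z s).snd - (v s).snd) b| ≤ D := by
    refine le_trans (le_of_eq ?_) (hD s)
    simp [l1Norm, abs_sub_comm]
  have h2 := mul_le_mul_of_nonneg_left hDs he0
  rw [payoff_sub_matrix, payoff_sub_matrix] at h1
  linarith [(abs_le.1 (h1.trans h2)).1]

end Equilibrium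

end MarkovGame

/-- Projections are nonexpansive, in terms of their variational inequalities. -/
theorem norm_sub_le_of_variational {E : Type*} [NormedAddCommGroup E] [InnerProductSpace ℝ E]
    {p q v z : E} (hv : inner ℝ (p - v) (z - v) ≤ 0) (hz : inner ℝ (q - z) (v - z) ≤ 0) :
    ‖v - z‖ ≤ ‖p - q‖ := by
  have h : inner ℝ (v - z) (v - z) ≤ inner ℝ (p - q) (v - z) := by
    have e : inner ℝ (v - z) (v - z) - inner ℝ (p - q) (v - z) =
        inner ℝ (p - v) (z - v) + inner ℝ (q - z) (v - z) := by
      rw [← neg_sub v z, inner_neg_right, ← sub_eq_neg_add, ← inner_sub_left, ← inner_sub_left]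
      congr 1
      module
    linarith
  rw [real_inner_self_eq_norm_sq] at h
  have h2 := real_inner_le_norm (p - q) (v - z)
  rcases (norm_nonneg (v - z)).eq_or_lt with h0 | h0
  · rw [← h0]; positivity
  · nlinarith

/-! ### Scalar inequalities behind the contraction -/

theorem sq_weighted_sum_le (a b g e : ℝ) :
    (3 * (a + b) + 2 * g + 2 * e) ^ 2 ≤ 36 * (a ^ 2 + b ^ 2) + 16 * g ^ 2 + 16 * e ^ 2 := by
  nlinarith [sq_nonneg (3 * a - 3 * b), sq_nonneg (3 * a - 2 * g), sq_nonneg (3 * a - 2 * e),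
    sq_nonneg (3 * b - 2 * g), sq_nonneg (3 * b - 2 * e), sq_nonneg (2 * g - 2 * e)]

theorem sq_add_div_le (r k : ℝ) : (r + (k + r) / 16) ^ 2 ≤ 4 * (r ^ 2 + k ^ 2 / 2) := by
  nlinarith [sq_nonneg (17 * r - k), sq_nonneg k, sq_nonneg r]

/-- Here `a = ‖w' - v‖`, `b = ‖v - w‖`, `ρ = dist(w', 𝒵*)`, `d = ‖v - z*‖` and `g` is the gap. In
the normalisation of `m`, the factor `N ^ 6 * H ^ 4` comes from squaring the coefficients, one `S`
from summing over states and the other from linearising `(η * g) ^ 2`. The number 256 makes the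
right side a small fraction of what the descent inequality offers. -/
theorem progress_arithmetic {S N H η c a b ρ d g m : ℝ} (hS : 1 ≤ S)
    (hN : 1 ≤ N) (hH : 1 ≤ H) (hη : 0 < η) (hηH : η * (32 * (N * H)) ≤ 1)
    (hmK : m * (256 * S ^ 2 * N ^ 6 * H ^ 4) = c ^ 2) (ha : 0 ≤ a) (hb : 0 ≤ b)
    (hg : 0 ≤ g) (hgS : g ≤ S * H)
    (hprog : (η * c * ρ) ^ 2 ≤
      S * (2 * (a + b) + 2 * η * (N * (H * (g + H * (N * d) ^ 2) + H * (N * a)))) ^ 2) :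
    m * η ^ 2 * ρ ^ 2 ≤ (36 * (a ^ 2 + b ^ 2) + 16 * (η * g) + 16 * (η ^ 2 * d ^ 4)) / 256 := by
  have hS0 : 0 < S := by linarith
  have hN0 : 0 < N := by linarith
  have hH0 : 0 < H := by linarith
  set Y := 3 * (a + b) + 2 * (η * g) + 2 * (η * d ^ 2) with hY
  have hX : 2 * (a + b) + 2 * η * (N * (H * (g + H * (N * d) ^ 2) + H * (N * a))) ≤
      N ^ 3 * H ^ 2 * Y := by
    have hN2 : N ≤ N ^ 3 := le_self_pow₀ hN (by norm_num)
    have hHH : H ≤ H ^ 2 := le_self_pow₀ hH (by norm_num)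
    have t1 : 2 * η * (N * (H * (N * a))) ≤ N * a := by
      have : 2 * (η * (N * H)) ≤ 1 := by linarith [mul_pos hη (mul_pos hN0 hH0)]
      calc 2 * η * (N * (H * (N * a))) = 2 * (η * (N * H)) * (N * a) := by ring
        _ ≤ 1 * (N * a) := by gcongr
        _ = N * a := one_mul _
    have t2 : 2 * (a + b) + N * a ≤ N ^ 3 * H ^ 2 * (3 * (a + b)) := by
      have h1 : 1 ≤ N ^ 3 * H ^ 2 :=
        one_le_mul_of_one_le_of_one_le (one_le_pow₀ hN) (one_le_pow₀ hH)
      have h2 : N ≤ N ^ 3 * H ^ 2 := hN2.trans (le_mul_of_one_le_right (by positivity)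
        (one_le_pow₀ hH))
      have h3 := mul_le_mul_of_nonneg_right h1 (by positivity : 0 ≤ 2 * (a + b))
      have h4 := mul_le_mul_of_nonneg_right h2 ha
      have h5 : 0 ≤ N ^ 3 * H ^ 2 * b := by positivity
      linarith
    have t3 : 2 * η * (N * (H * g)) ≤ N ^ 3 * H ^ 2 * (2 * (η * g)) := by
      have : N * H ≤ N ^ 3 * H ^ 2 := mul_le_mul hN2 hHH hH0.le (by positivity)
      have := mul_le_mul_of_nonneg_right this (by positivity : 0 ≤ 2 * (η * g))
      linarith
    have t4 : 2 * η * (N * (H * (H * (N * d) ^ 2))) = N ^ 3 * H ^ 2 * (2 * (η * d ^ 2)) := by ring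
    have : 2 * (a + b) + 2 * η * (N * (H * (g + H * (N * d) ^ 2) + H * (N * a))) =
        2 * (a + b) + 2 * η * (N * (H * (N * a))) + 2 * η * (N * (H * g)) +
          2 * η * (N * (H * (H * (N * d) ^ 2))) := by ring
    rw [this, t4, hY]
    linarith
  have hY2 : Y ^ 2 ≤ 36 * (a ^ 2 + b ^ 2) + 16 * (η * g) ^ 2 + 16 * (η ^ 2 * d ^ 4) := by
    have : η ^ 2 * d ^ 4 = (η * d ^ 2) ^ 2 := by ring
    rw [this, hY]
    exact sq_weighted_sum_le _ _ _ _
  -- The descent inequality supplies the gap only to first order, so its square is traded for a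
  -- linear term using `η * g ≤ S`.
  have hg2 : (η * g) ^ 2 ≤ S * (η * g) := by
    have h1 : η * g ≤ S := by
      have hηH1 : η * H ≤ 1 := by
        have : η * H ≤ η * (32 * (N * H)) := by
          gcongr
          nlinarith
        linarith
      calc η * g ≤ η * (S * H) := by gcongr
        _ = S * (η * H) := by ring
        _ ≤ S * 1 := by gcongr
        _ = S := mul_one S
    rw [sq]
    exact mul_le_mul_of_nonneg_right h1 (by positivity)
  have hY3 : Y ^ 2 ≤ S * (36 * (a ^ 2 + b ^ 2) + 16 * (η * g) + 16 * (η ^ 2 * d ^ 4)) := by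
    have h1 : 0 ≤ 36 * (a ^ 2 + b ^ 2) + 16 * (η ^ 2 * d ^ 4) := by positivity
    have h2 := mul_le_mul_of_nonneg_right hS h1
    linarith
  have hX0 : 0 ≤ 2 * (a + b) + 2 * η * (N * (H * (g + H * (N * d) ^ 2) + H * (N * a))) := by
    positivity
  have h1 : (η * c * ρ) ^ 2 ≤ S ^ 2 * N ^ 6 * H ^ 4 *
      (36 * (a ^ 2 + b ^ 2) + 16 * (η * g) + 16 * (η ^ 2 * d ^ 4)) := by
    calc (η * c * ρ) ^ 2 ≤ S * (N ^ 3 * H ^ 2 * Y) ^ 2 := by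
          refine hprog.trans ?_
          gcongr
      _ = S * (N ^ 6 * H ^ 4) * Y ^ 2 := by ring
      _ ≤ S * (N ^ 6 * H ^ 4) *
          (S * (36 * (a ^ 2 + b ^ 2) + 16 * (η * g) + 16 * (η ^ 2 * d ^ 4))) := by gcongr
      _ = _ := by ring
  have h2 : (η * c * ρ) ^ 2 = S ^ 2 * N ^ 6 * H ^ 4 * (256 * (m * η ^ 2 * ρ ^ 2)) := by
    rw [mul_pow, mul_pow, ← hmK]
    ring
  rw [h2] at h1
  have := le_of_mul_le_mul_left h1 (by positivity)
  linarith

/-- Smallness of `Θ` gives `d ≤ 2 * (ε * η ^ 2)`. In the cubic term one factor `d` is replaced by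
this bound and the other two by `4 * Θ`; the choice of `ε` then yields a small multiple of `m * η ^
2 * Θ`. The factor `η ^ 2` needed here is why the radius scales with the stepsize. -/
theorem error_terms_arithmetic {S N H η d m ε Θ : ℝ} (hS : 1 ≤ S) (hN : 1 ≤ N) (hH : 1 ≤ H)
    (hη : 0 < η) (hη1 : η ≤ 1) (hεm : ε * (64 * S * N ^ 3 * H ^ 2) = m) (hε0 : 0 < ε)
    (hm1 : m ≤ 1 / 256) (hd : 0 ≤ d) (hΘ0 : 0 ≤ Θ) (hd2 : d ^ 2 ≤ 4 * Θ)
    (hclose : Θ ≤ (ε * η ^ 2) ^ 2) :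
    S * H * (N * d) ≤ 1 / 2 ∧ 2 * η * (S * N ^ 3 * H ^ 2 * d ^ 3) ≤ m * η ^ 2 / 4 * Θ ∧
      η ^ 2 * d ^ 4 ≤ m * η ^ 2 / 4 * Θ := by
  have hS0 : 0 < S := by linarith
  have hN0 : 0 < N := by linarith
  have hH0 : 0 < H := by linarith
  have hm0 : 0 < m := by rw [← hεm]; positivity
  have hSNH : 1 ≤ S * N ^ 3 * H ^ 2 :=
    one_le_mul_of_one_le_of_one_le (one_le_mul_of_one_le_of_one_le hS (one_le_pow₀ hN))
      (one_le_pow₀ hH)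
  have hεm' : 64 * ε ≤ m := by
    have := mul_le_mul_of_nonneg_left hSNH (by positivity : 0 ≤ 64 * ε)
    linarith
  have hd1 : d ≤ 2 * (ε * η ^ 2) := by
    refine le_of_sq_le_sq ?_ (by positivity)
    rw [mul_pow]
    linarith
  have hη2 : η ^ 2 ≤ 1 := pow_le_one₀ hη.le hη1
  have hdε : d ≤ 2 * ε := by
    have := mul_le_mul_of_nonneg_left hη2 hε0.le
    linarith
  have hSNd : S * H * (N * d) ≤ 1 / 2 := by
    have h1 : S * N * H ≤ S * N ^ 3 * H ^ 2 := by
      have h2 : 1 ≤ N ^ 2 * H := one_le_mul_of_one_le_of_one_le (one_le_pow₀ hN) hH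
      calc S * N * H = S * N * H * 1 := by ring
        _ ≤ S * N * H * (N ^ 2 * H) := by gcongr
        _ = _ := by ring
    have h2 : S * N * H * d ≤ S * N ^ 3 * H ^ 2 * (2 * ε) := by gcongr
    linarith
  refine ⟨hSNd, ?_, ?_⟩
  · have h1 : S * N ^ 3 * H ^ 2 * d ^ 3 ≤ S * N ^ 3 * H ^ 2 * (2 * (ε * η ^ 2) * (4 * Θ)) := by
      rw [pow_succ' d 2]
      gcongr
    have h2 : S * N ^ 3 * H ^ 2 * (2 * (ε * η ^ 2) * (4 * Θ)) = m * η ^ 2 / 8 * Θ := by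
      rw [← hεm]
      ring
    have h3 : 0 ≤ m * η ^ 2 / 8 * Θ := by positivity
    rw [h2] at h1
    calc 2 * η * (S * N ^ 3 * H ^ 2 * d ^ 3) ≤ 2 * 1 * (m * η ^ 2 / 8 * Θ) := by gcongr
      _ = _ := by ring
  · have h1 : d ^ 4 ≤ (2 * ε) ^ 2 * (4 * Θ) := by
      have : d ^ 4 = d ^ 2 * d ^ 2 := by ring
      rw [this]
      exact mul_le_mul (pow_le_pow_left₀ hd hdε 2) hd2 (by positivity) (by positivity)
    have h2 : (2 * ε) ^ 2 * 4 ≤ m / 4 := by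
      have h3 : ε * (64 * ε) ≤ 1 / 64 * m := mul_le_mul (by linarith) hεm' (by positivity)
        (by positivity)
      linarith
    calc η ^ 2 * d ^ 4 ≤ η ^ 2 * ((2 * ε) ^ 2 * (4 * Θ)) := by gcongr
      _ = η ^ 2 * ((2 * ε) ^ 2 * 4 * Θ) := by ring
      _ ≤ η ^ 2 * (m / 4 * Θ) := by gcongr
      _ = _ := by ring

theorem condition_ratio_le {S N H c m : ℝ} (hS : 1 ≤ S) (hN : 1 ≤ N) (hH : 1 ≤ H) (hc : 0 < c)
    (hcN : c ≤ N * H) (hmK : m * (256 * S ^ 2 * N ^ 6 * H ^ 4) = c ^ 2) : m ≤ 1 / 256 := by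
  have h1 : c ^ 2 ≤ (N * H) ^ 2 := pow_le_pow_left₀ hc.le hcN 2
  have h2 : (N * H) ^ 2 ≤ S ^ 2 * N ^ 6 * H ^ 4 := by
    have h6 : 1 ≤ S ^ 2 * N ^ 4 * H ^ 2 :=
      one_le_mul_of_one_le_of_one_le (one_le_mul_of_one_le_of_one_le (one_le_pow₀ hS)
        (one_le_pow₀ hN)) (one_le_pow₀ hH)
    calc (N * H) ^ 2 = (N * H) ^ 2 * 1 := by ring
      _ ≤ (N * H) ^ 2 * (S ^ 2 * N ^ 4 * H ^ 2) := by gcongr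
      _ = _ := by ring
  have h3 : 0 < S ^ 2 * N ^ 6 * H ^ 4 := by positivity
  have h4 : m * 256 * (S ^ 2 * N ^ 6 * H ^ 4) ≤ 1 * (S ^ 2 * N ^ 6 * H ^ 4) := by linarith
  linarith [le_of_mul_le_mul_right h4 h3]

/-- The progress bound is added to the descent inequality. The terms `a ^ 2`, `b ^ 2` and `x` pay
for it, the summand `k ^ 2 / 2` of `Θ` pays for the gradient change, and the errors cost at most `μ
/ 2 * Θ`. The result `(1 + μ)Θ' ≤ (1 + μ/2)Θ` yields the factor `1 - μ/4`. -/
theorem combine_descent_arithmetic {μ a b k r ρ x e₁ e₂ y Θ : ℝ} (hΘ : Θ = r ^ 2 + k ^ 2 / 2)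
    (hμ0 : 0 < μ) (hμ1 : μ ≤ 1 / 256) (hx : 0 ≤ x)
    (hstep : ρ ^ 2 + a ^ 2 + b ^ 2 + y ≤ r ^ 2 + 2 * ((b + k) / 16) ^ 2) (hy : x - e₁ ≤ y)
    (hμ : μ * ρ ^ 2 ≤ (36 * (a ^ 2 + b ^ 2) + 16 * x + 16 * e₂) / 256)
    (he₁ : e₁ ≤ μ / 4 * Θ) (he₂ : e₂ ≤ μ / 4 * Θ) (he₂0 : 0 ≤ e₂) :
    ρ ^ 2 + a ^ 2 / 2 ≤ (1 - μ / 4) * Θ := by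
  have h1 : μ * (a ^ 2 / 2) ≤ 1 / 256 * (a ^ 2 / 2) := by gcongr
  have h2 : 2 * ((b + k) / 16) ^ 2 ≤ (b ^ 2 + k ^ 2) / 64 := by
    linarith [sq_nonneg (b - k), (by ring : (b - k) ^ 2 = b ^ 2 - 2 * (b * k) + k ^ 2),
      (by ring : ((b + k) / 16) ^ 2 = (b ^ 2 + 2 * (b * k) + k ^ 2) / 256)]
  have hfinal : (1 + μ) * (ρ ^ 2 + a ^ 2 / 2) ≤ (1 + μ / 2) * Θ := by
    have e : (1 + μ) * (ρ ^ 2 + a ^ 2 / 2) =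
        ρ ^ 2 + a ^ 2 / 2 + μ * ρ ^ 2 + μ * (a ^ 2 / 2) := by ring
    rw [e]
    linarith [sq_nonneg a, sq_nonneg b, sq_nonneg k]
  have hΘ0 : 0 ≤ Θ := by rw [hΘ]; positivity
  have h5 : (1 + μ / 2) * Θ ≤ (1 + μ) * ((1 - μ / 4) * Θ) := by
    have : 1 + μ / 2 ≤ (1 + μ) * (1 - μ / 4) := by nlinarith
    rw [← mul_assoc]
    gcongr
  exact le_of_mul_le_mul_left (hfinal.trans h5) (by positivity)

/-- The arithmetic behind the contraction of the Lyapunov function `ρ² + a² / 2`. -/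
theorem lyapunov_contraction_arithmetic {S N H η c a b k r ρ d g I m ε : ℝ} (hS : 1 ≤ S)
    (hN : 1 ≤ N) (hH : 1 ≤ H) (hη : 0 < η) (hηH : η * (32 * (N * H)) ≤ 1) (hc : 0 < c)
    (hcN : c ≤ N * H) (hm : m = c ^ 2 / (256 * S ^ 2 * N ^ 6 * H ^ 4))
    (hε : ε = m / (64 * S * N ^ 3 * H ^ 2)) (ha : 0 ≤ a) (hb : 0 ≤ b)
    (hd : 0 ≤ d) (hg : 0 ≤ g) (hgS : g ≤ S * H)
    (hclose : r ^ 2 + k ^ 2 / 2 ≤ (ε * η ^ 2) ^ 2)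
    (hstep : ρ ^ 2 + a ^ 2 + b ^ 2 + 2 * η * I ≤ r ^ 2 + 2 * ((b + k) / 16) ^ 2)
    (hI : g - S * (H * (g + H * (N * d) ^ 2) * (N * d)) ≤ I)
    (hdist : d ≤ r + (k + r) / 16)
    (hprog : (η * c * ρ) ^ 2 ≤
      S * (2 * (a + b) + 2 * η * (N * (H * (g + H * (N * d) ^ 2) + H * (N * a)))) ^ 2) :
    ρ ^ 2 + a ^ 2 / 2 ≤ (1 - m * η ^ 2 / 4) * (r ^ 2 + k ^ 2 / 2) := by
  have hS0 : 0 < S := by linarith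
  have hN0 : 0 < N := by linarith
  have hH0 : 0 < H := by linarith
  have hmK : m * (256 * S ^ 2 * N ^ 6 * H ^ 4) = c ^ 2 := by rw [hm]; field_simp
  have hεm : ε * (64 * S * N ^ 3 * H ^ 2) = m := by rw [hε]; field_simp
  have hm0 : 0 < m := by rw [hm]; positivity
  have hε0 : 0 < ε := by rw [hε]; positivity
  have hm1 : m ≤ 1 / 256 := condition_ratio_le hS hN hH hc hcN hmK
  have hη1 : η ≤ 1 := by
    have h1 : 1 ≤ N * H := one_le_mul_of_one_le_of_one_le hN hH
    have := mul_le_mul_of_nonneg_left h1 hη.le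
    linarith
  have hd2 : d ^ 2 ≤ 4 * (r ^ 2 + k ^ 2 / 2) :=
    (pow_le_pow_left₀ hd hdist 2).trans (sq_add_div_le r k)
  obtain ⟨hSNd, herr1, herr2⟩ := error_terms_arithmetic hS hN hH hη hη1 hεm hε0 hm1 hd
    (by positivity) hd2 hclose
  -- Since `S * H * (N * d) ≤ 1 / 2`, the error proportional to the gap uses up at most half of it.
  have hI2 : η * g - 2 * η * (S * N ^ 3 * H ^ 2 * d ^ 3) ≤ 2 * η * I := by
    have h1 := mul_le_mul_of_nonneg_right hSNd hg
    have h2 : g / 2 - S * N ^ 3 * H ^ 2 * d ^ 3 ≤ I := by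
      refine le_trans ?_ hI
      have : S * (H * (g + H * (N * d) ^ 2) * (N * d)) =
          S * H * (N * d) * g + S * N ^ 3 * H ^ 2 * d ^ 3 := by ring
      rw [this]
      linarith
    have := mul_le_mul_of_nonneg_left h2 (by positivity : 0 ≤ 2 * η)
    linarith
  have hμ1 : m * η ^ 2 ≤ 1 / 256 :=
    (mul_le_of_le_one_right hm0.le (pow_le_one₀ hη.le hη1)).trans hm1
  exact combine_descent_arithmetic rfl (by positivity) hμ1 (by positivity) hstep hI2
    (progress_arithmetic hS hN hH hη hηH hmK ha hb hg hgS hprog) herr1 herr2 (by positivity)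

namespace MarkovGame

variable {S A B : Type} [Fintype S] [Fintype A] [Fintype B] [Nonempty A] [Nonempty B]

/-! ### One step of the algorithm -/

theorem inner_nearestPoint_nonpos {ι : Type} [Fintype ι] [Nonempty ι] (v : EuclideanSpace ℝ ι)
    {q : EuclideanSpace ℝ ι} (hq : q ∈ probSimplex ι) :
    inner ℝ (v - nearestPoint (probSimplex ι) v) (q - nearestPoint (probSimplex ι) v) ≤ 0 :=
  inner_sub_nonpos_of_forall_dist_le (convex_probSimplex ι) (nearestPoint_probSimplex_spec v).1
    (nearestPoint_probSimplex_spec v).2 q hq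

section Step

variable {G : MarkovGame S A B} {η : ℝ} {u z w : JointPair S A B}

theorem IsStep.mem_policyPairs (h : G.IsStep η u z w) : w ∈ policyPairs S A B := fun s => by
  rw [(h s).1, (h s).2]
  exact ⟨(nearestPoint_probSimplex_spec _).1, (nearestPoint_probSimplex_spec _).1⟩

theorem IsStep.inner_local_nonpos (h : G.IsStep η u z w) (s : S) {p : LocalPair A B}
    (hp1 : p.fst ∈ probSimplex A) (hp2 : p.snd ∈ probSimplex B) :
    inner ℝ (u s - η • G.field z s - w s) (p - w s) ≤ 0 := by
  have h1 := inner_nearestPoint_nonpos ((u s).fst - η • G.gradX z s) hp1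
  have h2 := inner_nearestPoint_nonpos ((u s).snd + η • G.gradY z s) hp2
  rw [← (h s).1] at h1
  rw [← (h s).2] at h2
  rw [WithLp.prod_inner_apply]
  have e : (u s).snd + η • G.gradY z s - (w s).snd =
      (u s).snd - η • (-G.gradY z s) - (w s).snd := by simp
  rw [e] at h2
  exact add_nonpos h1 h2

theorem IsStep.inner_nonpos (h : G.IsStep η u z w) {p : JointPair S A B}
    (hp : p ∈ policyPairs S A B) : inner ℝ (u - η • G.field z - w) (p - w) ≤ 0 := by
  rw [PiLp.inner_apply]
  exact Finset.sum_nonpos fun s _ => h.inner_local_nonpos s (hp s).1 (hp s).2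

end Step

theorem duality_gap_le {M : Matrix A B ℝ} {x : EuclideanSpace ℝ A} {y : EuclideanSpace ℝ B} {r : ℝ}
    (h : ∀ x' ∈ probSimplex A, ∀ y' ∈ probSimplex B, payoff M x y' - payoff M x' y ≤ r) :
    maxPayoff M x - minPayoff M y ≤ r := by
  have : maxPayoff M x ≤ r + minPayoff M y := maxPayoff_le fun y' hy' => by
    have : payoff M x y' - r ≤ minPayoff M y := le_minPayoff fun x' hx' => by
      linarith [h x' hx' y' hy']
    linarith
  linarith

/-- The duality gap is at most `N * H` times the distance to the saddle set, and a non-equilibrium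
has positive distance in some state. Were all pairs equilibria, every positive number would be an
error-bound constant. -/
theorem IsErrorBoundConst.le_of_exists_notMem {G : MarkovGame S A B} {c : ℝ}
    (hc : G.IsErrorBoundConst c) {z : JointPair S A B} (hz : z ∈ policyPairs S A B)
    (hz' : z ∉ G.zStar) : c ≤ actionCount A B * G.horizon := by
  obtain ⟨s, hs⟩ : ∃ s, z s ∉ G.zStarAt s := by
    by_contra hcon
    push Not at hcon
    exact hz' hcon
  obtain ⟨p, hp, hpd⟩ :=
    (G.isClosed_zStarAt s).exists_infDist_eq_dist (G.zStarAt_nonempty s) (z s)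
  have hpos : 0 < Metric.infDist (z s) (G.zStarAt s) :=
    ((G.isClosed_zStarAt s).notMem_iff_infDist_pos (G.zStarAt_nonempty s)).1 hs
  have h1 := hc.2 z hz s
  have hsad : IsSaddle (G.qStar s) (G.gameValue s) p.fst p.snd := by rwa [zStarAt_eq] at hp
  have h2 : maxPayoff (G.qStar s) (z s).fst - minPayoff (G.qStar s) (z s).snd ≤
      G.horizon * l1Norm (z s - p) := by
    refine duality_gap_le fun x' hx' y' hy' => ?_
    have e1 := (abs_le.1 (abs_payoff_sub_le (G.abs_qStar_le s) (x := (z s).fst) (y := y') (y' := y')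
      hp.1.1 hy')).2
    have e2 := (abs_le.1 (abs_payoff_sub_le (G.abs_qStar_le s) (x := x') (y' := (z s).snd)
      hx' hp.2.1)).2
    have e3 : l1Norm (z s - p) =
        ∑ a, |((z s).fst - p.fst) a| + ∑ b, |(p.snd - (z s).snd) b| := by
      simp [l1Norm, abs_sub_comm]
    rw [e3]
    simp only [sub_self, PiLp.zero_apply, abs_zero, Finset.sum_const_zero, add_zero,
      zero_add] at e1 e2
    linarith [hsad.2.2.1 y' hy', hsad.2.2.2 x' hx']
  have h3 := mul_le_mul_of_nonneg_left (l1Norm_le (z s - p)) G.horizon_pos.le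
  rw [← dist_eq_norm, ← hpd] at h3
  refine le_of_mul_le_mul_right ?_ hpos
  linarith

/-- The length of an extragradient step bounds the distance to the equilibria of its end point. -/
theorem mul_infDist_zStarAt_le {G : MarkovGame S A B} {c η D : ℝ} (hc : G.IsErrorBoundConst c)
    (hη : 0 < η) {w v w' z : JointPair S A B} (hv : v ∈ policyPairs S A B) (hz : z ∈ G.zStar)
    (hstep : G.IsStep η w v w') (hD : ∀ s, l1Norm (v s - z s) ≤ D) (s : S) :
    η * c * Metric.infDist (w' s) (G.zStarAt s) ≤
      2 * (‖w' - v‖ + ‖v - w‖) + 2 * η * (actionCount A B *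
        (G.horizon * (G.relGap v z + G.horizon * D ^ 2) +
          G.horizon * (actionCount A B * ‖w' - v‖))) := by
  have hw' := hstep.mem_policyPairs
  set N := actionCount A B
  have hN : 1 ≤ N := one_le_actionCount
  set e := G.horizon * (G.relGap v z + G.horizon * D ^ 2) with he
  have hH := G.horizon_pos.le
  have he0 : 0 ≤ e := by
    have h2 := G.relGap_nonneg hv hz
    positivity
  have hQ : ∀ a b, |(G.qStar s - G.pairQ v s) a b| ≤ e := fun a b => by
    have := G.abs_pairQ_sub_qStar_le hv hz hD s a b
    rwa [Matrix.sub_apply, abs_sub_comm] at this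
  -- The step was taken with `pairQ v s` at `v`, whereas the error bound concerns `qStar s` at `w'`.
  -- Passing between them costs `e` for the matrix and a Lipschitz term for the point.
  have hF : ‖localField (G.qStar s) (w' s) - localField (G.pairQ v s) (v s)‖ ≤
      N * (e + G.horizon * (N * ‖w' - v‖)) := by
    have h1 := norm_sq_localField_sub_le hQ (G.abs_pairQ_le hv s) hH (w := w' s) (w' := v s)
      (hw' s).1 (hw' s).2
    have h2 : l1Norm (w' s - v s) ≤ N * ‖w' - v‖ := (l1Norm_le _).trans
      (mul_le_mul_of_nonneg_left (norm_apply_le (w' - v) s) (by linarith))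
    refine le_of_sq_le_sq (h1.trans ?_) (by positivity)
    have h0 := l1Norm_nonneg (w' s - v s)
    rw [mul_pow]
    gcongr
    nlinarith
  have hgap : maxPayoff (G.qStar s) (w' s).fst - minPayoff (G.qStar s) (w' s).snd ≤
      (2 * ‖w' - w‖ + 2 * η * (N * (e + G.horizon * (N * ‖w' - v‖)))) / η := by
    refine duality_gap_le fun x' hx' y' hy' => ?_
    rw [le_div_iff₀ hη]
    set p : LocalPair A B := WithLp.toLp 2 (x', y') with hp
    have hp2 : ‖w' s - p‖ ≤ 2 := norm_sub_le_two_of_mem (hw' s).1 (hw' s).2 hx' hy'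
    have e1 : payoff (G.qStar s) (w' s).fst y' - payoff (G.qStar s) x' (w' s).snd =
        inner ℝ (localField (G.qStar s) (w' s)) (w' s - p) := by
      rw [inner_localField]
      change _ = payoff _ ((w' s).fst - x') _ - payoff _ _ ((w' s).snd - y')
      rw [payoff_sub_left, payoff_sub_right]
      ring
    -- The first term is nonpositive by optimality of the projection `w'`, the second is controlled
    -- by the step length, the third by the discrepancy of the fields. The factor 2 in the bounds
    -- below is a bound on the diameter of the product of simplices.
    have e2 : η * inner ℝ (localField (G.qStar s) (w' s)) (w' s - p) =
        inner ℝ (w s - η • G.field v s - w' s) (p - w' s) + inner ℝ (w' s - w s) (p - w' s) +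
        η * inner ℝ (localField (G.qStar s) (w' s) - localField (G.pairQ v s) (v s))
          (w' s - p) := by
      change _ = inner ℝ (w s - η • localField (G.pairQ v s) (v s) - w' s) (p - w' s) + _ + _
      rw [← neg_sub (w' s) p, inner_neg_right, inner_neg_right]
      simp only [inner_sub_left, real_inner_smul_left]
      ring
    have h1 := hstep.inner_local_nonpos s (p := p) hx' hy'
    have h2 : inner ℝ (w' s - w s) (p - w' s) ≤ ‖w' - w‖ * 2 := by
      refine (real_inner_le_norm _ _).trans ?_
      rw [norm_sub_rev p]
      exact mul_le_mul (norm_apply_le (w' - w) s) hp2 (norm_nonneg _) (norm_nonneg _)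
    have h3 : inner ℝ (localField (G.qStar s) (w' s) - localField (G.pairQ v s) (v s)) (w' s - p) ≤
        N * (e + G.horizon * (N * ‖w' - v‖)) * 2 :=
      (real_inner_le_norm _ _).trans (mul_le_mul hF hp2 (norm_nonneg _) (by positivity))
    have h4 := mul_le_mul_of_nonneg_left h3 hη.le
    rw [e1, mul_comm, e2]
    linarith
  have h1 := (hc.2 w' hw' s).trans hgap
  rw [le_div_iff₀ hη] at h1
  have h2 : ‖w' - w‖ ≤ ‖w' - v‖ + ‖v - w‖ := norm_sub_le_norm_sub_add_norm_sub _ _ _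
  linarith

/-! ### The Lyapunov function and its contraction along the algorithm -/

/-- The Lyapunov function of the algorithm. -/
def lyapunov (G : MarkovGame S A B) (w u : JointPair S A B) : ℝ :=
  Metric.infDist w G.zStar ^ 2 + ‖w - u‖ ^ 2 / 2

/-- The ratio of the squared error bound constant to a polynomial in the size of the game. -/
def conditionRatio (G : MarkovGame S A B) (c : ℝ) : ℝ :=
  c ^ 2 / (256 * (Fintype.card S : ℝ) ^ 2 * actionCount A B ^ 6 * G.horizon ^ 4)

/-- Up to a square and the stepsize, the radius of the neighborhood in which the algorithm
contracts. -/
def localRadius (G : MarkovGame S A B) (c : ℝ) : ℝ :=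
  G.conditionRatio c / (64 * (Fintype.card S : ℝ) * actionCount A B ^ 3 * G.horizon ^ 2)

/-- One full iteration: `w` and `u` are the old auxiliary and played pairs, `v` the new played pair
and `w'` the new auxiliary pair. The equilibrium `z` nearest to `w` serves as reference point, and
the descent, distance and progress estimates feed `lyapunov_contraction_arithmetic`. -/
theorem lyapunov_step_le [Nonempty S] {G : MarkovGame S A B} {c η : ℝ}
    (hc : G.IsErrorBoundConst c) (hcN : c ≤ actionCount A B * G.horizon) (hη : 0 < η)
    (hηL : η * (32 * √(Fintype.card S) * actionCount A B * G.horizon ^ 2) ≤ 1)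
    {w u v w' : JointPair S A B} (hu : u ∈ policyPairs S A B)
    (h1 : G.IsStep η w u v) (h2 : G.IsStep η w v w')
    (hclose : G.lyapunov w u ≤ (G.localRadius c * η ^ 2) ^ 2) :
    G.lyapunov w' v ≤ (1 - G.conditionRatio c * η ^ 2 / 4) * G.lyapunov w u := by
  have hv := h1.mem_policyPairs
  have hw' := h2.mem_policyPairs
  obtain ⟨z, hz, hzd⟩ := G.isClosed_zStar.exists_infDist_eq_dist G.zStar_nonempty w
  have hz' := G.zStar_subset_policyPairs hz
  rw [dist_eq_norm] at hzd
  have hS : (1 : ℝ) ≤ Fintype.card S := by exact_mod_cast Fintype.card_pos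
  have hN : 1 ≤ actionCount A B := one_le_actionCount
  have hH := G.one_le_horizon
  -- The Lipschitz constant of the field is `2√S N H²`, and the stepsize condition is `η * 32√S N H²
  -- ≤ 1`; this leaves 1/16.
  have hLip : ∀ {p q : JointPair S A B}, p ∈ policyPairs S A B → q ∈ policyPairs S A B →
      η * ‖G.field p - G.field q‖ ≤ ‖p - q‖ / 16 := fun {p q} hp hq => by
    have h := mul_le_mul_of_nonneg_left (G.norm_field_sub_le hp hq) hη.le
    have h' := mul_le_mul_of_nonneg_right hηL (norm_nonneg (p - q))
    linarith
  have hηH : η * (32 * (actionCount A B * G.horizon)) ≤ 1 := by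
    refine le_trans (mul_le_mul_of_nonneg_left ?_ hη.le) hηL
    have hs : 1 ≤ √(Fintype.card S : ℝ) := Real.one_le_sqrt.2 hS
    calc 32 * (actionCount A B * G.horizon) = 32 * 1 * actionCount A B * G.horizon ^ 1 := by ring
      _ ≤ _ := by gcongr; norm_num
  have hD : ∀ s, l1Norm (v s - z s) ≤ actionCount A B * ‖v - z‖ := fun s =>
    (l1Norm_le _).trans (mul_le_mul_of_nonneg_left (norm_apply_le (v - z) s) (by linarith))
  refine lyapunov_contraction_arithmetic (I := inner ℝ (G.field v) (v - z)) (d := ‖v - z‖)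
    (g := G.relGap v z) (b := ‖v - w‖) hS hN hH hη hηH hc.1 hcN rfl rfl (norm_nonneg _)
    (norm_nonneg _) (norm_nonneg _) (G.relGap_nonneg hv hz) (G.relGap_le hv hz) hclose ?_
    (G.relGap_sub_le_inner_field hv hz hD) ?_ ?_
  · have h3 := optimistic_step_inequality hη.le (h1.inner_nonpos hw') (h2.inner_nonpos hv)
      (h2.inner_nonpos hz')
    have h4 : Metric.infDist w' G.zStar ≤ ‖w' - z‖ := by
      rw [← dist_eq_norm]
      exact Metric.infDist_le_dist_of_mem hz
    have h5 := pow_le_pow_left₀ Metric.infDist_nonneg h4 2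
    have h6 : η * ‖G.field v - G.field u‖ ≤ (‖v - w‖ + ‖w - u‖) / 16 := by
      linarith [hLip hv hu, norm_sub_le_norm_sub_add_norm_sub v w u]
    have h7 := pow_le_pow_left₀ (by positivity) h6 2
    rw [hzd]
    linarith
  -- The equilibrium `z` is fixed by its own projected step, so nonexpansiveness compares `v` with
  -- `z` and gives `‖v - z‖ ≤ ‖w - z‖ + η‖F(u) - F(z)‖`.
  · have h3 : inner ℝ (z - η • G.field z - z) (v - z) ≤ 0 := by
      have := mul_nonneg hη.le (G.inner_field_equilibrium_nonneg hz hv)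
      rw [sub_sub_cancel_left, inner_neg_left, real_inner_smul_left]
      linarith
    have h4 := norm_sub_le_of_variational (h1.inner_nonpos hz') h3
    have h5 : w - η • G.field u - (z - η • G.field z) =
        (w - z) - η • (G.field u - G.field z) := by module
    rw [h5] at h4
    have h6 := h4.trans (norm_sub_le _ _)
    rw [norm_smul, Real.norm_of_nonneg hη.le] at h6
    rw [hzd]
    linarith [hLip hu hz', norm_sub_le_norm_sub_add_norm_sub u w z, norm_sub_rev u w]
  · have h3 := mul_infDist_zStarAt_le hc hη hv hz h2 hD
    rw [mul_pow]
    refine (mul_le_mul_of_nonneg_left (G.infDist_zStar_sq_le w') (sq_nonneg _)).trans ?_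
    rw [Finset.mul_sum]
    refine (Finset.sum_le_card_nsmul _ _ _ fun s _ => ?_).trans (le_of_eq (nsmul_eq_mul _ _))
    rw [← mul_pow]
    refine pow_le_pow_left₀ ?_ (h3 s) 2
    have := hc.1
    have : 0 ≤ Metric.infDist (w' s) (G.zStarAt s) := Metric.infDist_nonneg
    positivity

theorem infDist_sq_le_lyapunov (G : MarkovGame S A B) (w u : JointPair S A B) :
    Metric.infDist u G.zStar ^ 2 ≤ 4 * G.lyapunov w u := by
  have h1 : Metric.infDist u G.zStar ≤ Metric.infDist w G.zStar + ‖w - u‖ := by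
    rw [norm_sub_rev, ← dist_eq_norm]
    exact Metric.infDist_le_infDist_add_dist
  have h2 := pow_le_pow_left₀ Metric.infDist_nonneg h1 2
  unfold lyapunov
  linarith [sq_nonneg (Metric.infDist w G.zStar - ‖w - u‖), sq_nonneg (Metric.infDist w G.zStar),
    (by ring : (Metric.infDist w G.zStar + ‖w - u‖) ^ 2 = 2 * Metric.infDist w G.zStar ^ 2 +
      2 * ‖w - u‖ ^ 2 - (Metric.infDist w G.zStar - ‖w - u‖) ^ 2)]

theorem conditionRatio_le [Nonempty S] {G : MarkovGame S A B} {c : ℝ} (hc0 : 0 < c)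
    (hcN : c ≤ actionCount A B * G.horizon) : G.conditionRatio c ≤ 1 / 256 := by
  have hS : (1 : ℝ) ≤ Fintype.card S := by exact_mod_cast Fintype.card_pos
  have hN : 1 ≤ actionCount A B := one_le_actionCount
  refine condition_ratio_le hS hN G.one_le_horizon hc0 hcN (div_mul_cancel₀ _ ?_)
  have := G.horizon_pos
  positivity

theorem conditionRatio_pos [Nonempty S] (G : MarkovGame S A B) {c : ℝ} (hc0 : 0 < c) :
    0 < G.conditionRatio c := by
  have hS : (1 : ℝ) ≤ Fintype.card S := by exact_mod_cast Fintype.card_pos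
  have hN : 1 ≤ actionCount A B := one_le_actionCount
  have := G.horizon_pos
  unfold conditionRatio
  positivity

theorem IsOGDA.mem_policyPairs {G : MarkovGame S A B} {T₁ T₂ : ℕ} {zhat : JointPair S A B} {η : ℝ}
    {z zt : ℕ → JointPair S A B} (h : G.IsOGDA T₁ T₂ zhat η z zt)
    (hzhat : zhat ∈ policyPairs S A B) {t : ℕ} (h1 : T₁ ≤ t) (h2 : t ≤ T₂) :
    z t ∈ policyPairs S A B ∧ zt t ∈ policyPairs S A B := by
  obtain ⟨h0, h0', hs⟩ := h
  rcases h1.eq_or_lt with rfl | h1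
  · rw [h0, h0']
    exact ⟨hzhat, hzhat⟩
  · obtain ⟨t, rfl⟩ : ∃ t', t = t' + 1 := ⟨t - 1, by omega⟩
    have := hs t (by omega) (by omega)
    exact ⟨this.1.mem_policyPairs, this.2.mem_policyPairs⟩

/-- Optimistic gradient descent/ascent contracts the Lyapunov function near the equilibria. -/
theorem IsOGDA.lyapunov_le [Nonempty S] {G : MarkovGame S A B} {T₁ T₂ : ℕ}
    {zhat : JointPair S A B} {c η : ℝ} {z zt : ℕ → JointPair S A B}
    (h : G.IsOGDA T₁ T₂ zhat η z zt) (hzhat : zhat ∈ policyPairs S A B)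
    (hc : G.IsErrorBoundConst c) (hcN : c ≤ actionCount A B * G.horizon) (hη : 0 < η)
    (hη1 : η ≤ 1)
    (hηL : η * (32 * √(Fintype.card S) * actionCount A B * G.horizon ^ 2) ≤ 1)
    (hclose : Metric.infDist zhat G.zStar ^ 2 ≤ (G.localRadius c * η ^ 2) ^ 2) (k : ℕ)
    (hk : T₁ + k ≤ T₂) :
    G.lyapunov (zt (T₁ + k)) (z (T₁ + k)) ≤
      (1 - G.conditionRatio c * η ^ 2 / 4) ^ k * Metric.infDist zhat G.zStar ^ 2 := by
  have hm0 := G.conditionRatio_pos hc.1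
  have hm1 := conditionRatio_le hc.1 hcN
  have hη2 : η ^ 2 ≤ 1 := pow_le_one₀ hη.le hη1
  have hq1 : 1 - G.conditionRatio c * η ^ 2 / 4 ≤ 1 := by
    have : 0 ≤ G.conditionRatio c * η ^ 2 := by positivity
    linarith
  have hq0 : 0 ≤ 1 - G.conditionRatio c * η ^ 2 / 4 := by
    have : G.conditionRatio c * η ^ 2 ≤ 1 / 256 * 1 := by gcongr
    linarith
  induction k with
  | zero => simp [lyapunov, h.1, h.2.1]
  | succ k ih =>
    have ih := ih (by omega)
    have hu := (h.mem_policyPairs hzhat (t := T₁ + k) (by omega) (by omega)).1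
    obtain ⟨h1, h2⟩ := h.2.2 (T₁ + k) (by omega) (by omega)
    -- The rate is at most one, so the iterates never leave the neighborhood in which a step
    -- contracts.
    have hsmall : G.lyapunov (zt (T₁ + k)) (z (T₁ + k)) ≤ (G.localRadius c * η ^ 2) ^ 2 :=
      ih.trans ((mul_le_of_le_one_left (sq_nonneg _) (pow_le_one₀ hq0 hq1)).trans hclose)
    have h3 := lyapunov_step_le hc hcN hη hηL hu h1 h2 hsmall
    rw [← add_assoc, pow_succ', mul_assoc]
    exact h3.trans (mul_le_mul_of_nonneg_left ih hq0)

/-- The Lipschitz estimate needs only `(1 - γ) ^ 2`, which dominates the `5 / 2` power since `1 - γ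
≤ 1`. -/
theorem stepsize_mul_le [Nonempty S] (G : MarkovGame S A B) {η : ℝ}
    (h : η ≤ (1 - G.disc) ^ (5 / 2 : ℝ) / (32 * √(Fintype.card S : ℝ) * actionCount A B)) :
    η * (32 * √(Fintype.card S) * actionCount A B * G.horizon ^ 2) ≤ 1 := by
  have hS : (0 : ℝ) < Fintype.card S := by exact_mod_cast Fintype.card_pos
  have hN : 1 ≤ actionCount A B := one_le_actionCount
  have hγ : 0 < 1 - G.disc := sub_pos.2 G.disc_lt_one
  have hpos : 0 < 32 * √(Fintype.card S : ℝ) * actionCount A B := by positivity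
  rw [le_div_iff₀ hpos] at h
  have h1 : (1 - G.disc) ^ (5 / 2 : ℝ) ≤ (1 - G.disc) ^ 2 := by
    rw [← Real.rpow_natCast]
    exact Real.rpow_le_rpow_of_exponent_ge hγ (by linarith [G.disc_nonneg]) (by norm_num)
  have h2 : (1 - G.disc) ^ 2 * G.horizon ^ 2 = 1 := by
    rw [← mul_pow, horizon, mul_one_div_cancel hγ.ne', one_pow]
  calc η * (32 * √(Fintype.card S) * actionCount A B * G.horizon ^ 2) =
        η * (32 * √(Fintype.card S) * actionCount A B) * G.horizon ^ 2 := by ring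
    _ ≤ (1 - G.disc) ^ 2 * G.horizon ^ 2 := by gcongr; exact h.trans h1
    _ = 1 := h2

end MarkovGame

/-! ### Choice of the constants and conclusion -/

open MarkovGame in
/-- The convergence rate and the radius of convergence. -/
theorem exists_rate_and_radius {S A B : ℕ} (hS : 0 < S) (hA : 0 < A) (hB : 0 < B)
    (G : MarkovGame (Fin S) (Fin A) (Fin B)) {c : ℝ} (hc : G.IsErrorBoundConst c) :
    ∃ c₀ δ₀ : ℝ, 0 < c₀ ∧ c₀ < 1 ∧ 0 < δ₀ ∧
      ((∃ z ∈ policyPairs (Fin S) (Fin A) (Fin B), z ∉ G.zStar) →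
        c ^ 2 ≤ c₀ * (64 / 3 * (S : ℝ) ^ 2 * ((A : ℝ) + B) ^ 6 * G.horizon ^ 4)) ∧
      c ^ 4 ≤ δ₀ * (16384 * (S : ℝ) ^ 3 * ((A : ℝ) + B) ^ 9 * G.horizon ^ 6) ^ 2 ∧
      ∀ η : ℝ, 0 < η →
        η ≤ (1 - G.disc) ^ (5 / 2 : ℝ) / (32 * √(S : ℝ) * ((A : ℝ) + (B : ℝ))) →
      ∀ (T₁ T₂ : ℕ) (zhat : JointPair (Fin S) (Fin A) (Fin B))
        (z zt : ℕ → JointPair (Fin S) (Fin A) (Fin B)),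
        zhat ∈ policyPairs (Fin S) (Fin A) (Fin B) →
        G.IsOGDA T₁ T₂ zhat η z zt →
        Metric.infDist zhat G.zStar ^ 2 ≤ δ₀ * η ^ 4 →
        ∀ t : ℕ, T₁ ≤ t → t ≤ T₂ →
          Metric.infDist (z t) G.zStar ^ 2 ≤
            8 * (S : ℝ) / (1 - G.disc) * (1 - c₀ * η ^ 2 / 48) ^ (t - T₁) *
              Metric.infDist zhat G.zStar ^ 2 := by
  have : Nonempty (Fin S) := ⟨⟨0, hS⟩⟩
  have : Nonempty (Fin A) := ⟨⟨0, hA⟩⟩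
  have : Nonempty (Fin B) := ⟨⟨0, hB⟩⟩
  have hc0 := hc.1
  have hH := G.one_le_horizon
  have hS1 : (1 : ℝ) ≤ S := by exact_mod_cast hS
  have hN1 : (1 : ℝ) ≤ (A : ℝ) + B := by exact_mod_cast (by omega : 1 ≤ A + B)
  have hN : actionCount (Fin A) (Fin B) = (A : ℝ) + B := by simp [actionCount]
  -- The bound `c ≤ N * H`, and with it `conditionRatio c ≤ 1 / 256`, is available only if some pair
  -- is not an equilibrium.
  by_cases hex : ∃ z ∈ policyPairs (Fin S) (Fin A) (Fin B), z ∉ G.zStar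
  · obtain ⟨z₀, hz₀, hz₀'⟩ := hex
    have hcN := hc.le_of_exists_notMem hz₀ hz₀'
    have hm0 := G.conditionRatio_pos hc0
    have hm1 := conditionRatio_le hc0 hcN
    have hmeq : G.conditionRatio c = c ^ 2 / (256 * (S : ℝ) ^ 2 * ((A : ℝ) + B) ^ 6 *
        G.horizon ^ 4) := by simp [conditionRatio, hN]
    have heq : G.localRadius c = G.conditionRatio c / (64 * (S : ℝ) * ((A : ℝ) + B) ^ 3 *
        G.horizon ^ 2) := by simp [localRadius, hN]
    have hr0 : 0 < G.localRadius c := by rw [heq]; positivity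
    -- The factor 12 turns `c₀ * η ^ 2 / 48` into the proved `m * η ^ 2 / 4`, and `12 / 256 < 1`.
    -- Squaring the radius makes `δ₀ * η ^ 4` equal to `(ε * η ^ 2) ^ 2`.
    refine ⟨12 * G.conditionRatio c, G.localRadius c ^ 2, by positivity, by linarith, by positivity,
      fun _ => le_of_eq ?_, le_of_eq ?_, ?_⟩
    · rw [hmeq]
      field_simp
      norm_num
    · rw [heq, hmeq]
      field_simp
      norm_num
    · intro η hη hηle T₁ T₂ zhat z zt hzhat hrun hclose t ht1 ht2
      have hηL := G.stepsize_mul_le (η := η) (by simpa [hN] using hηle)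
      have hη1 : η ≤ 1 := by
        have h1 : 1 ≤ 32 * √(Fintype.card (Fin S)) * actionCount (Fin A) (Fin B) *
            G.horizon ^ 2 := by
          have h2 : 1 ≤ √(Fintype.card (Fin S) : ℝ) := Real.one_le_sqrt.2 (by simpa using hS1)
          rw [hN]
          exact one_le_mul_of_one_le_of_one_le (one_le_mul_of_one_le_of_one_le
            (one_le_mul_of_one_le_of_one_le (by norm_num) h2) hN1) (one_le_pow₀ hH)
        exact (le_mul_of_one_le_right hη.le h1).trans hηL
      have hclose' : Metric.infDist zhat G.zStar ^ 2 ≤ (G.localRadius c * η ^ 2) ^ 2 := by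
        rw [mul_pow, ← pow_mul]
        exact hclose
      have h1 := hrun.lyapunov_le hzhat hc hcN hη hη1 hηL hclose' (t - T₁) (by omega)
      rw [Nat.add_sub_cancel' ht1] at h1
      have h2 := (G.infDist_sq_le_lyapunov (zt t) (z t)).trans
        (mul_le_mul_of_nonneg_left h1 (by norm_num))
      have e1 : 1 - 12 * G.conditionRatio c * η ^ 2 / 48 = 1 - G.conditionRatio c * η ^ 2 / 4 := by
        ring
      have e2 : 8 * (S : ℝ) / (1 - G.disc) = 8 * (S : ℝ) * G.horizon := by
        rw [horizon, mul_one_div]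
      have hq0 : 0 ≤ 1 - G.conditionRatio c * η ^ 2 / 4 := by
        have : G.conditionRatio c * η ^ 2 ≤ 1 / 256 * 1 := by
          gcongr
          exact pow_le_one₀ hη.le hη1
        linarith
      rw [e1, e2, mul_assoc]
      -- The argument yields the constant 4, which is below `8 * S * H`.
      refine h2.trans (mul_le_mul_of_nonneg_right ?_ (by positivity))
      have := one_le_mul_of_one_le_of_one_le hS1 hH
      linarith
  -- All pairs are equilibria: both distances vanish, so any rate works, and `c ^ 4` is taken as
  -- radius because `c` may be arbitrarily large.
  · refine ⟨1 / 2, c ^ 4, by norm_num, by norm_num, by positivity, fun h => absurd h hex,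
      le_mul_of_one_le_right (by positivity) ?_, ?_⟩
    · exact one_le_pow₀ (one_le_mul_of_one_le_of_one_le (one_le_mul_of_one_le_of_one_le
        (one_le_mul_of_one_le_of_one_le (by norm_num) (one_le_pow₀ hS1)) (one_le_pow₀ hN1))
        (one_le_pow₀ hH))
    · intro η _ _ T₁ T₂ zhat z zt hzhat hrun _ t ht1 ht2
      push Not at hex
      have h1 := hex _ (hrun.mem_policyPairs hzhat ht1 ht2).1
      simp [Metric.infDist_zero_of_mem h1, Metric.infDist_zero_of_mem (hex _ hzhat)]

end

theorem theorem5 :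
    ∃ p q : MvPolynomial (Fin 4) ℝ,
      ∀ (S A B : ℕ), 0 < S → 0 < A → 0 < B →
      ∀ G : MarkovGame (Fin S) (Fin A) (Fin B),
        (∃ cPlus : ℝ, G.IsErrorBoundConst cPlus) ∧
        ∀ cPlus : ℝ, G.IsErrorBoundConst cPlus →
          ∃ c₀ δ₀ : ℝ, 0 < c₀ ∧ c₀ < 1 ∧ 0 < δ₀ ∧
            ((∃ z ∈ MarkovGame.policyPairs (Fin S) (Fin A) (Fin B), z ∉ G.zStar) →
              cPlus ^ 2 ≤ c₀ * MvPolynomial.eval ![(S : ℝ), (A : ℝ), (B : ℝ), 1 / (1 - G.disc)] p) ∧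
            cPlus ^ 4 ≤ δ₀ * MvPolynomial.eval ![(S : ℝ), (A : ℝ), (B : ℝ), 1 / (1 - G.disc)] q ∧
            ∀ η : ℝ, 0 < η →
              η ≤ (1 - G.disc) ^ (5 / 2 : ℝ) / (32 * √(S : ℝ) * ((A : ℝ) + (B : ℝ))) →
            ∀ (T₁ T₂ : ℕ) (zhat : JointPair (Fin S) (Fin A) (Fin B))
              (z zt : ℕ → JointPair (Fin S) (Fin A) (Fin B)),
              zhat ∈ MarkovGame.policyPairs (Fin S) (Fin A) (Fin B) →
              G.IsOGDA T₁ T₂ zhat η z zt →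
              Metric.infDist zhat G.zStar ^ 2 ≤ δ₀ * η ^ 4 →
              ∀ t : ℕ, T₁ ≤ t → t ≤ T₂ →
                Metric.infDist (z t) G.zStar ^ 2 ≤
                  8 * (S : ℝ) / (1 - G.disc) * (1 - c₀ * η ^ 2 / 48) ^ (t - T₁) *
                    Metric.infDist zhat G.zStar ^ 2 := by
  -- The coefficients are `64 / 3 = 256 / 12` from `c₀ = 12m`, and `16384 = 256 * 64` from `ε`,
  -- squared because `δ₀ = ε²`.
  refine ⟨.C (64 / 3) * .X 0 ^ 2 * (.X 1 + .X 2) ^ 6 * .X 3 ^ 4,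
    (.C 16384 * .X 0 ^ 3 * (.X 1 + .X 2) ^ 9 * .X 3 ^ 6) ^ 2, fun S A B hS hA hB G => ⟨?_, ?_⟩⟩
  · have : Nonempty (Fin A) := ⟨⟨0, hA⟩⟩
    have : Nonempty (Fin B) := ⟨⟨0, hB⟩⟩
    exact G.exists_isErrorBoundConst
  · intro c hc
    simp only [map_mul, map_pow, map_add, MvPolynomial.eval_C, MvPolynomial.eval_X]
    exact exists_rate_and_radius hS hA hB G hc
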